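/- Let $n\ge 0$ and let $\phi:\mathbb{R}^n\to\mathbb{R}$ be a $\mathcal C^1$, strictly convex function such that $\lim_{\|x\|\to\infty}\phi(x)/\|x\|=\infty$, where $\|\cdot\|$ is the Euclidean norm. Let $U:\mathbb{R}^n\to\mathbb{R}$ be a bounded (Lebesgue measurable) function, and put $\Phi=\phi+U$ and $\operatorname{osc}(U)=\sup U-\inf U$. Let $\phi^*(y)=\sup_{z\in\mathbb{R}^n}\{y\cdot z-\phi(z)\}$ be the Fenchel--Legendre transform of $\phi$. Then $Z_\Phi=\int_{\mathbb{R}^n} e^{-\Phi(x)}\,dx<\infty$, so that $$d\mu_\Phi(x)=\frac{e^{-\Phi(x)}}{Z_\Phi}\,dx$$ is a probability measure on $\mathbb{R}^n$. Moreover, let $g:\mathbb{R}^n\to\mathbb{R}$ be any $\mathcal C^1$ function such that $e^g$ and $$\left\{x\cdot\nabla g(x)-\phi^*(\nabla\phi(x))+\phi^*\big(\nabla\phi(x)-\nabla g(x)\big)\right\}e^{g(x)}$$ are $\mu_\Phi$-integrable. Then the function $e^g\log\frac{e^g}{\int e^g\,d\mu_\Phi}$ is $\mu_\Phi$-integrable,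 and $$\operatorname{Ent}_{\mu_\Phi}(e^g):=\int e^g\log\frac{e^g}{\int e^g\,d\mu_\Phi}\,d\mu_\Phi\le e^{2\operatorname{osc}(U)}\int\left\{x\cdot\nabla g(x)-\phi^*(\nabla\phi(x))+\phi^*\big(\nabla\phi(x)-\nabla g(x)\big)\right\}e^{g(x)}\,d\mu_\Phi(x).$$ -/

import Mathlib

open MeasureTheory Filter

namespace GibbsEntropy

noncomputable section

/-- The Fenchel-Legendre transform `φ^*(y) = sup_z (y · z - φ z)`. -/
def legendre {n : ℕ} (φ : EuclideanSpace ℝ (Fin n) → ℝ) (y : EuclideanSpace ℝ (Fin n)) : ℝ :=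
  ⨆ z : EuclideanSpace ℝ (Fin n), (inner ℝ y z - φ z)

/-- The measure `μ_Φ(dx) = (e^{-Φ(x)} / ∫ e^{-Φ}) dx`. -/
def gibbs {n : ℕ} (Φ : EuclideanSpace ℝ (Fin n) → ℝ) : Measure (EuclideanSpace ℝ (Fin n)) :=
  volume.withDensity
    (fun x => ENNReal.ofReal (Real.exp (-Φ x) / ∫ z, Real.exp (-Φ z)))

/-- The integrand `f log (f / ∫ f dμ)` of the entropy of `f`. -/
def entropyIntegrand {α : Type*} [MeasurableSpace α] (μ : Measure α) (f : α → ℝ) (x : α) : ℝ :=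
  f x * Real.log (f x / ∫ z, f z ∂μ)

/-- The entropy `Ent_μ(f) = ∫ f log (f / ∫ f dμ) dμ`. -/
def entropy {α : Type*} [MeasurableSpace α] (μ : Measure α) (f : α → ℝ) : ℝ :=
  ∫ x, entropyIntegrand μ f x ∂μ

/-- The oscillation `sup U - inf U` of a bounded function. -/
def osc {α : Type*} (U : α → ℝ) : ℝ :=
  (⨆ x, U x) - ⨅ x, U x

/-- The function `x · ∇g(x) - φ^*(∇φ(x)) + φ^*(∇φ(x) - ∇g(x))`. -/
def energyDensity {n : ℕ} (φ g : EuclideanSpace ℝ (Fin n) → ℝ)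
    (x : EuclideanSpace ℝ (Fin n)) : ℝ :=
  inner ℝ x (gradient g x) - legendre φ (gradient φ x)
    + legendre φ (gradient φ x - gradient g x)

/-- For a continuous superlinear `φ` the supremum defining `φ^*` is finite everywhere. -/
theorem legendre_bddAbove {n : ℕ} (φ : EuclideanSpace ℝ (Fin n) → ℝ) (hc : Continuous φ)
    (hs : Tendsto (fun x => φ x / ‖x‖) (cocompact (EuclideanSpace ℝ (Fin n))) atTop)
    (y : EuclideanSpace ℝ (Fin n)) :
    BddAbove (Set.range fun z : EuclideanSpace ℝ (Fin n) => inner ℝ y z - φ z) := by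
  obtain ⟨K, hK, hK'⟩ := mem_cocompact.1 (hs.eventually_ge_atTop ‖y‖)
  have hcont : Continuous fun z : EuclideanSpace ℝ (Fin n) => inner ℝ y z - φ z := by fun_prop
  obtain ⟨M, hM⟩ := hK.bddAbove_image hcont.continuousOn
  refine ⟨max (max M 0) (-φ 0), ?_⟩
  rintro _ ⟨z, rfl⟩
  by_cases hz : z ∈ K
  · exact ((hM ⟨z, hz, rfl⟩).trans (le_max_left _ _)).trans (le_max_left _ _)
  · have h1 : ‖y‖ ≤ φ z / ‖z‖ := hK' hz
    rcases eq_or_ne z 0 with rfl | h0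
    · simp
    · rw [le_div_iff₀ (norm_pos_iff.2 h0)] at h1
      have h2 := real_inner_le_norm y z
      have h3 : inner ℝ y z - φ z ≤ 0 := by linarith
      exact (h3.trans (le_max_right _ _)).trans (le_max_left _ _)

end

end GibbsEntropy

/-! Write c(x, p) for `legendreCost`, so that the energy density of g is E(x) = c(x, ∇g(x)). In p
this cost is convex, nonnegative, and zero at p = 0.

Take first U = 0 and g ≤ 0 with compact support. The inequality is then the derivative at t = 0 of
the Prékopa–Leindler inequality with weights 1 - t and t, applied to e^{g-φ} and e^{-φ}. If z = (1 -
t)x + ty, then (1 - t)(g(x) - g(z)) is about t ∇g(z)·(z - y), which Fenchel–Young bounds by t E(z)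
plus the Jensen gap of φ. Hence, for small t and uniformly in x and y, e^{g-φ} e^{t(E-g+ε)} is an
admissible third function (`exists_forall_sub_le_of_hasCompactSupport`). Both sides equal ∫ e^{g-φ}
at t = 0, and comparing first-order terms gives `mul_log_le_integral_of_hasCompactSupport`.

For general g, convexity of the cost makes truncation cheap. A maximum with a barrier built from φ
gives compact support; since c(x, ∇φ(x)) = φ(x) + φ*(0), its extra energy is a tail of an integrable
function. A truncation above then removes g ≤ 0. Fatou's lemma for the nonnegative integrand x
log(x/a) - x + a carries the entropy to the limit (`EntropyLE.of_tendsto`).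

Finally U enters by Holley–Stroock: each of the two Gibbs measures is at most e^{osc U} times the
other. One comparison is spent on the entropy and one on the energy, whence e^{2 osc U}. -/

/-! ### Brunn–Minkowski on the line -/

/-- The translates K + inf L and sup K + L both lie in C and meet at most in the point sup K + inf
L. -/
theorem volume_add_volume_le_of_isCompact {K L C : Set ℝ} (hK : IsCompact K) (hL : IsCompact L)
    (hK0 : K.Nonempty) (hL0 : L.Nonempty) (hC : ∀ a ∈ K, ∀ b ∈ L, a + b ∈ C) :
    volume K + volume L ≤ volume C := by
  have hm := hK.sSup_mem hK0
  have hl := hL.sInf_mem hL0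
  set m := sSup K
  set l := sInf L
  have h1 : volume ((fun x => x + l) '' K) = volume K := by simp
  have h2 : volume ((fun x => m + x) '' L) = volume L := by simp
  have hLm : MeasurableSet ((fun x => m + x) '' L) :=
    (hL.image (by fun_prop)).measurableSet
  have h3 : volume ((fun x => x + l) '' K ∩ (fun x => m + x) '' L) = 0 := by
    refine measure_mono_null (t := {m + l}) ?_ (by simp)
    rintro _ ⟨⟨a, ha, rfl⟩, ⟨b, hb, hab⟩⟩
    have h4 : a ≤ m := le_csSup hK.bddAbove ha
    have h5 : l ≤ b := csInf_le hL.bddBelow hb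
    simp only at hab ⊢
    simp only [Set.mem_singleton_iff]
    linarith
  have h4 := measure_union_add_inter (μ := volume) ((fun x => x + l) '' K) hLm
  rw [h3, h1, h2, add_zero] at h4
  rw [← h4]
  refine measure_mono (Set.union_subset ?_ ?_)
  · rintro _ ⟨a, ha, rfl⟩
    exact hC a ha l hl
  · rintro _ ⟨b, hb, rfl⟩
    exact hC m hm b hb

theorem volume_add_volume_le {A B C : Set ℝ} (hA : MeasurableSet A) (hB : MeasurableSet B)
    (hA0 : A.Nonempty) (hB0 : B.Nonempty) (hC : ∀ a ∈ A, ∀ b ∈ B, a + b ∈ C) :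
    volume A + volume B ≤ volume C := by
  obtain ⟨a0, ha0⟩ := hA0
  obtain ⟨b0, hb0⟩ := hB0
  rw [hA.measure_eq_iSup_isCompact, hB.measure_eq_iSup_isCompact]
  simp only [iSup_and']
  refine ENNReal.biSup_add_biSup_le' ⟨∅, by simp⟩ ⟨∅, by simp⟩ ?_
  rintro K ⟨hKA, hK⟩ L ⟨hLB, hL⟩
  -- The approximating compacts may be empty; inserting `a0` and `b0` makes them nonempty.
  refine (add_le_add (measure_mono (Set.subset_insert a0 K))
    (measure_mono (Set.subset_insert b0 L))).trans ?_
  refine volume_add_volume_le_of_isCompact (hK.insert a0) (hL.insert b0)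
    (Set.insert_nonempty _ _) (Set.insert_nonempty _ _) fun a ha b hb => hC a ?_ b ?_
  · exact Set.insert_subset ha0 hKA ha
  · exact Set.insert_subset hb0 hLB hb

theorem volume_convex_comb_le {t : ℝ} (ht0 : 0 < t) (ht1 : t < 1) {A B C : Set ℝ}
    (hA : MeasurableSet A) (hB : MeasurableSet B)
    (hA0 : A.Nonempty) (hB0 : B.Nonempty) (hC : ∀ a ∈ A, ∀ b ∈ B, (1 - t) * a + t * b ∈ C) :
    ENNReal.ofReal (1 - t) * volume A + ENNReal.ofReal t * volume B ≤ volume C := by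
  have key : ∀ s : ℝ, 0 < s → ∀ D : Set ℝ, MeasurableSet D →
      MeasurableSet ((fun x => s * x) '' D) ∧
        volume ((fun x => s * x) '' D) = ENNReal.ofReal s * volume D := by
    intro s hs D hD
    refine ⟨(MeasurableEquiv.mulLeft₀ s hs.ne').measurableSet_image.2 hD, ?_⟩
    have h := Measure.addHaar_smul (volume : Measure ℝ) s D
    rw [Module.finrank_self, pow_one, abs_of_pos hs] at h
    exact h
  obtain ⟨h1, h2⟩ := key (1 - t) (by linarith) A hA
  obtain ⟨h3, h4⟩ := key t ht0 B hB
  rw [← h2, ← h4]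
  refine volume_add_volume_le h1 h3 (hA0.image _) (hB0.image _) ?_
  rintro _ ⟨a, ha, rfl⟩ _ ⟨b, hb, rfl⟩
  exact hC a ha b hb

/-! ### The Prékopa–Leindler inequality -/

theorem lintegral_eq_lintegral_meas_ofReal_lt {f : ℝ → ENNReal} (hf : Measurable f) :
    ∫⁻ x, f x = ∫⁻ s in Set.Ioi (0 : ℝ), volume {x | ENNReal.ofReal s < f x} := by
  have h0 : MeasurableSet {p : ℝ × ℝ | ENNReal.ofReal p.1 < f p.2} :=
    measurableSet_lt (by fun_prop) (by fun_prop)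
  have h1 : ∀ c : ENNReal,
      ∫⁻ s in Set.Ioi (0 : ℝ), Set.indicator {s : ℝ | ENNReal.ofReal s < c} 1 s = c := by
    intro c
    rw [lintegral_indicator_one (measurableSet_lt (by fun_prop) (by fun_prop)),
      Measure.restrict_apply (measurableSet_lt (by fun_prop) (by fun_prop))]
    induction c with
    | top => simp
    | coe c =>
      have : {s : ℝ | ENNReal.ofReal s < c} ∩ Set.Ioi 0 = Set.Ioo 0 (c : ℝ) := by
        ext s
        simp only [Set.mem_inter_iff, Set.mem_ofPred_eq, Set.mem_Ioi, Set.mem_Ioo]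
        rw [and_comm]
        refine and_congr_right fun hs => ?_
        rw [ENNReal.ofReal_lt_iff_lt_toReal hs.le (by simp)]
        simp
      rw [this]
      simp
  calc ∫⁻ x, f x
      = ∫⁻ x, ∫⁻ s in Set.Ioi (0 : ℝ),
          Set.indicator {p : ℝ × ℝ | ENNReal.ofReal p.1 < f p.2} 1 (s, x) := by
        refine lintegral_congr fun x => (h1 (f x)).symm.trans ?_
        rfl
    _ = ∫⁻ s in Set.Ioi (0 : ℝ), ∫⁻ x,
          Set.indicator {p : ℝ × ℝ | ENNReal.ofReal p.1 < f p.2} 1 (s, x) := by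
        refine lintegral_lintegral_swap ?_
        refine Measurable.aemeasurable ?_
        exact (measurable_one.indicator h0).comp measurable_swap
    _ = _ := by
        refine lintegral_congr fun s => ?_
        rw [← lintegral_indicator_one (measurableSet_lt (by fun_prop) hf)]
        rfl

/-- The Prékopa–Leindler inequality with weights `1 - t` and `t`, as a property of a measure. -/
def PrekopaLeindler {V : Type*} [AddCommGroup V] [Module ℝ V] [MeasurableSpace V]
    (μ : Measure V) (t : ℝ) : Prop :=
  ∀ f g H : V → ENNReal, Measurable f → Measurable g → Measurable H →
    (∀ x y, f x ^ (1 - t) * g y ^ t ≤ H ((1 - t) • x + t • y)) →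
    (∫⁻ x, f x ∂μ) ^ (1 - t) * (∫⁻ x, g x ∂μ) ^ t ≤ ∫⁻ x, H x ∂μ

theorem ENNReal.rpow_mul_rpow_le_weighted_add {t : ℝ} (ht0 : 0 < t) (ht1 : t < 1) (a b : ENNReal) :
    a ^ (1 - t) * b ^ t ≤ ENNReal.ofReal (1 - t) * a + ENNReal.ofReal t * b := by
  have h1 : 0 < 1 - t := by linarith
  induction a with
  | top => rw [ENNReal.mul_top (by simpa using h1), top_add]; exact le_top
  | coe a =>
    induction b with
    | top => rw [ENNReal.mul_top (by simpa using ht0), add_top]; exact le_top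
    | coe b =>
      have := NNReal.geom_mean_le_arith_mean2_weighted (1 - t).toNNReal t.toNNReal a b (by
        rw [← Real.toNNReal_add h1.le ht0.le]; simp)
      rw [Real.coe_toNNReal _ h1.le, Real.coe_toNNReal _ ht0.le] at this
      rw [← ENNReal.coe_rpow_of_nonneg _ h1.le, ← ENNReal.coe_rpow_of_nonneg _ ht0.le]
      rw [ENNReal.ofReal, ENNReal.ofReal]
      exact_mod_cast this

/-- With both suprema equal to 1, the level sets {f > s} and {g > s} are nonempty for exactly the
same levels, s < 1. There (1 - t){f > s} + t{g > s} ⊆ {H > s}, so Brunn–Minkowski can be integrated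
over s. -/
theorem lintegral_weighted_add_le_of_iSup_eq_one {t : ℝ} (ht0 : 0 < t) (ht1 : t < 1)
    {f g H : ℝ → ENNReal} (hf : Measurable f) (hg : Measurable g) (hH : Measurable H)
    (hf1 : ⨆ x, f x = 1) (hg1 : ⨆ x, g x = 1)
    (h : ∀ x y, f x ^ (1 - t) * g y ^ t ≤ H ((1 - t) * x + t * y)) :
    ENNReal.ofReal (1 - t) * (∫⁻ x, f x) + ENNReal.ofReal t * (∫⁻ x, g x) ≤ ∫⁻ x, H x := by
  have hm : ∀ {u : ℝ → ENNReal}, Measurable u →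
      Measurable fun s : ℝ => volume {x | ENNReal.ofReal s < u x} := by
    intro u hu
    exact measurable_measure_prodMk_left
      (measurableSet_lt (by fun_prop) (by fun_prop) :
        MeasurableSet {p : ℝ × ℝ | ENNReal.ofReal p.1 < u p.2})
  rw [lintegral_eq_lintegral_meas_ofReal_lt hf, lintegral_eq_lintegral_meas_ofReal_lt hg,
    lintegral_eq_lintegral_meas_ofReal_lt hH, ← lintegral_const_mul _ (hm hf),
    ← lintegral_const_mul _ (hm hg), ← lintegral_add_left ((hm hf).const_mul _)]
  refine setLIntegral_mono (hm hH) fun s hs => ?_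
  have hs : 0 < s := hs
  by_cases hs1 : s < 1
  · have hs1' : ENNReal.ofReal s < 1 := by simpa using hs1
    refine volume_convex_comb_le ht0 ht1 (measurableSet_lt (by fun_prop) hf)
      (measurableSet_lt (by fun_prop) hg) ?_ ?_ ?_
    · obtain ⟨x, hx⟩ := lt_iSup_iff.1 (hf1.symm ▸ hs1')
      exact ⟨x, hx⟩
    · obtain ⟨x, hx⟩ := lt_iSup_iff.1 (hg1.symm ▸ hs1')
      exact ⟨x, hx⟩
    · intro a ha b hb
      refine lt_of_lt_of_le ?_ (h a b)
      have h1 := ENNReal.rpow_lt_rpow ha (show 0 < 1 - t by linarith)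
      have h2 := ENNReal.rpow_lt_rpow hb ht0
      refine lt_of_eq_of_lt ?_ (ENNReal.mul_lt_mul h1 h2)
      rw [← ENNReal.rpow_add _ _ (by simpa using hs) (by simp)]
      simp
  · have h1 : (1 : ENNReal) ≤ ENNReal.ofReal s := by simpa using hs1
    have h2 : {x | ENNReal.ofReal s < f x} = ∅ := by
      ext x
      simp only [Set.mem_ofPred_eq, Set.mem_empty_iff_false, iff_false, not_lt]
      exact ((le_iSup f x).trans_eq hf1).trans h1
    have h3 : {x | ENNReal.ofReal s < g x} = ∅ := by
      ext x
      simp only [Set.mem_ofPred_eq, Set.mem_empty_iff_false, iff_false, not_lt]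
      exact ((le_iSup g x).trans_eq hg1).trans h1
    simp [h2, h3]

/-- Dividing by the suprema reduces to the normalised additive form; the weighted AM–GM inequality
turns it multiplicative, and the constants cancel by homogeneity. -/
theorem lintegral_rpow_mul_le_of_iSup_ne_top {t : ℝ} (ht0 : 0 < t) (ht1 : t < 1)
    {f g H : ℝ → ENNReal} (hf : Measurable f) (hg : Measurable g) (hH : Measurable H)
    (hf1 : ⨆ x, f x ≠ ⊤) (hg1 : ⨆ x, g x ≠ ⊤)
    (h : ∀ x y, f x ^ (1 - t) * g y ^ t ≤ H ((1 - t) * x + t * y)) :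
    (∫⁻ x, f x) ^ (1 - t) * (∫⁻ x, g x) ^ t ≤ ∫⁻ x, H x := by
  have h1t : 0 < 1 - t := by linarith
  set a := ⨆ x, f x with ha
  set b := ⨆ x, g x with hb
  rcases eq_or_ne a 0 with ha0 | ha0
  · have : ∀ x, f x = 0 := fun x => le_antisymm ((le_iSup f x).trans_eq (ha.symm.trans ha0)) bot_le
    simp [this, h1t]
  rcases eq_or_ne b 0 with hb0 | hb0
  · have : ∀ x, g x = 0 := fun x => le_antisymm ((le_iSup g x).trans_eq (hb.symm.trans hb0)) bot_le
    simp [this, ht0]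
  set c := a⁻¹ ^ (1 - t) * b⁻¹ ^ t with hc
  have hai : a⁻¹ ≠ ⊤ := ENNReal.inv_ne_top.2 ha0
  have hbi : b⁻¹ ≠ ⊤ := ENNReal.inv_ne_top.2 hb0
  have hai0 : a⁻¹ ≠ 0 := ENNReal.inv_ne_zero.2 hf1
  have hbi0 : b⁻¹ ≠ 0 := ENNReal.inv_ne_zero.2 hg1
  have hc0 : c ≠ 0 := mul_ne_zero (by simp [ENNReal.rpow_eq_zero_iff, hai, hai0])
    (by simp [ENNReal.rpow_eq_zero_iff, hbi, hbi0])
  have hct : c ≠ ⊤ := ENNReal.mul_ne_top (ENNReal.rpow_ne_top_of_nonneg h1t.le hai)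
    (ENNReal.rpow_ne_top_of_nonneg ht0.le hbi)
  have key := lintegral_weighted_add_le_of_iSup_eq_one ht0 ht1 (hf.const_mul a⁻¹)
    (hg.const_mul b⁻¹) (hH.const_mul c)
    (by rw [← ENNReal.mul_iSup, ← ha, ENNReal.inv_mul_cancel ha0 hf1])
    (by rw [← ENNReal.mul_iSup, ← hb, ENNReal.inv_mul_cancel hb0 hg1]) (by
      intro x y
      rw [ENNReal.mul_rpow_of_nonneg _ _ h1t.le, ENNReal.mul_rpow_of_nonneg _ _ ht0.le,
        mul_mul_mul_comm]
      gcongr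
      exact h x y)
  have key2 := (ENNReal.rpow_mul_rpow_le_weighted_add ht0 ht1 _ _).trans key
  rw [lintegral_const_mul _ hf, lintegral_const_mul _ hg, lintegral_const_mul _ hH,
    ENNReal.mul_rpow_of_nonneg _ _ h1t.le, ENNReal.mul_rpow_of_nonneg _ _ ht0.le,
    mul_mul_mul_comm] at key2
  exact (ENNReal.mul_le_mul_iff_right hc0 hct).1 key2

theorem ENNReal.lintegral_eq_iSup_min {α : Type*} [MeasurableSpace α] {μ : Measure α}
    {f : α → ENNReal} (hf : Measurable f) :
    ∫⁻ x, f x ∂μ = ⨆ n : ℕ, ∫⁻ x, min (f x) n ∂μ := by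
  rw [← lintegral_iSup (fun n => hf.min measurable_const) (by
    intro i j hij x
    exact min_le_min_left _ (by exact_mod_cast hij))]
  refine lintegral_congr fun x => ?_
  rw [← inf_iSup_eq, ENNReal.iSup_natCast, inf_top_eq]

theorem ENNReal.iSup_rpow {ι : Type*} (u : ι → ENNReal) {r : ℝ} (hr : 0 < r) :
    (⨆ i, u i) ^ r = ⨆ i, u i ^ r :=
  (ENNReal.orderIsoRpow r hr).map_iSup u

theorem prekopaLeindler_real {t : ℝ} (ht0 : 0 < t) (ht1 : t < 1) :
    PrekopaLeindler (volume : Measure ℝ) t := by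
  intro f g H hf hg hH h
  have h1t : 0 < 1 - t := by linarith
  rw [ENNReal.lintegral_eq_iSup_min hf, ENNReal.lintegral_eq_iSup_min hg,
    ENNReal.iSup_rpow _ h1t, ENNReal.iSup_rpow _ ht0, ENNReal.iSup_mul]
  refine iSup_le fun i => ?_
  rw [ENNReal.mul_iSup]
  refine iSup_le fun j => ?_
  refine lintegral_rpow_mul_le_of_iSup_ne_top ht0 ht1 (hf.min measurable_const)
    (hg.min measurable_const) hH ?_ ?_ ?_
  · exact ne_top_of_le_ne_top (ENNReal.natCast_ne_top i) (iSup_le fun x => min_le_right _ _)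
  · exact ne_top_of_le_ne_top (ENNReal.natCast_ne_top j) (iSup_le fun x => min_le_right _ _)
  · intro x y
    refine le_trans ?_ (h x y)
    gcongr <;> exact min_le_left _ _

/-- For fixed x and x', the inequality on the fibres is precisely the hypothesis needed for the
marginals. -/
theorem PrekopaLeindler.prod {V W : Type*} [AddCommGroup V] [Module ℝ V] [MeasurableSpace V]
    [AddCommGroup W] [Module ℝ W] [MeasurableSpace W] {μ : Measure V} {ν : Measure W}
    [SFinite μ] [SFinite ν] {t : ℝ} (h1 : PrekopaLeindler μ t) (h2 : PrekopaLeindler ν t) :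
    PrekopaLeindler (μ.prod ν) t := by
  intro f g H hf hg hH h
  rw [lintegral_prod _ hf.aemeasurable, lintegral_prod _ hg.aemeasurable,
    lintegral_prod _ hH.aemeasurable]
  refine h1 _ _ _ hf.lintegral_prod_right' hg.lintegral_prod_right' hH.lintegral_prod_right' ?_
  intro x x'
  refine h2 _ _ _ (by fun_prop) (by fun_prop) (by fun_prop) ?_
  intro y y'
  exact h (x, y) (x', y')

theorem PrekopaLeindler.map {V W : Type*} [AddCommGroup V] [Module ℝ V] [MeasurableSpace V]
    [AddCommGroup W] [Module ℝ W] [MeasurableSpace W] {μ : Measure V} {ν : Measure W}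
    {t : ℝ} (h1 : PrekopaLeindler μ t) {e : V → W} (he : MeasurePreserving e μ ν)
    (hadd : ∀ x y, e ((1 - t) • x + t • y) = (1 - t) • e x + t • e y) :
    PrekopaLeindler ν t := by
  intro f g H hf hg hH h
  rw [← he.lintegral_comp hf, ← he.lintegral_comp hg, ← he.lintegral_comp hH]
  refine h1 _ _ _ (hf.comp he.measurable) (hg.comp he.measurable) (hH.comp he.measurable) ?_
  intro x y
  rw [hadd]
  exact h _ _

theorem prekopaLeindler_pi {t : ℝ} (ht0 : 0 < t) (ht1 : t < 1) (n : ℕ) :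
    PrekopaLeindler (volume : Measure (Fin n → ℝ)) t := by
  induction n with
  | zero =>
    intro f g H hf hg hH h
    rw [Measure.volume_pi_eq_dirac 0, lintegral_dirac, lintegral_dirac, lintegral_dirac]
    have := h 0 0
    simpa using this
  | succ n ih =>
    refine ((prekopaLeindler_real ht0 ht1).prod ih).map
      (volume_preserving_piFinSuccAbove (fun _ => ℝ) 0).symm ?_
    rintro ⟨x, x'⟩ ⟨y, y'⟩
    ext i
    refine Fin.cases ?_ (fun j => ?_) i <;> simp [MeasurableEquiv.piFinSuccAbove]

theorem prekopaLeindler_euclideanSpace {t : ℝ} (ht0 : 0 < t) (ht1 : t < 1) (n : ℕ) :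
    PrekopaLeindler (volume : Measure (EuclideanSpace ℝ (Fin n))) t :=
  (prekopaLeindler_pi ht0 ht1 n).map (PiLp.volume_preserving_toLp (Fin n)) fun _ _ => rfl

/-! ### A C¹ positive part -/

/-- A `C¹` approximation of the positive part: it vanishes for `u ≤ 0`, equals `u - 1/2` for
`1 ≤ u`, and is quadratic in between. -/
noncomputable def smoothPosPart (u : ℝ) : ℝ := (max u 0 ^ 2 - max (u - 1) 0 ^ 2) / 2

/-- The derivative of `smoothPosPart`. -/
noncomputable def smoothPosPartDeriv (u : ℝ) : ℝ := max u 0 - max (u - 1) 0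

theorem hasDerivAt_max_zero_sq (u : ℝ) : HasDerivAt (fun x : ℝ => max x 0 ^ 2) (2 * max u 0) u := by
  rcases lt_trichotomy u 0 with h | rfl | h
  · rw [max_eq_right h.le, mul_zero]
    refine (hasDerivAt_const u (0 : ℝ)).congr_of_eventuallyEq ?_
    filter_upwards [eventually_lt_nhds h] with x hx
    simp [max_eq_right hx.le]
  -- At the corner the function is dominated by x², which is o(x).
  · have h : HasDerivAt (fun x : ℝ => x ^ 2) 0 0 := by simpa using hasDerivAt_pow 2 (0 : ℝ)
    rw [max_self, mul_zero]
    rw [hasDerivAt_iff_isLittleO] at h ⊢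
    refine (Asymptotics.IsBigO.of_bound 1 (Eventually.of_forall fun x => ?_)).trans_isLittleO h
    simp only [max_self, smul_zero, sub_zero, one_mul, Real.norm_eq_abs, ne_eq, OfNat.ofNat_ne_zero,
      not_false_eq_true, zero_pow, abs_pow, sq_abs]
    rcases le_total x 0 with hx | hx
    · simp [max_eq_right hx, sq_nonneg]
    · simp [max_eq_left hx]
  · rw [max_eq_left h.le]
    have h2 : HasDerivAt (fun x : ℝ => x ^ 2) (2 * u) u := by simpa using hasDerivAt_pow 2 u
    refine h2.congr_of_eventuallyEq ?_
    filter_upwards [eventually_gt_nhds h] with x hx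
    simp [max_eq_left hx.le]

theorem hasDerivAt_smoothPosPart (u : ℝ) :
    HasDerivAt smoothPosPart (smoothPosPartDeriv u) u := by
  have h1 := hasDerivAt_max_zero_sq u
  have h2 := (hasDerivAt_max_zero_sq (u - 1)).comp_sub_const u 1
  have h3 := (h1.sub h2).div_const 2
  refine h3.congr_deriv ?_
  unfold smoothPosPartDeriv
  ring

theorem contDiff_smoothPosPart : ContDiff ℝ 1 smoothPosPart := by
  rw [contDiff_one_iff_deriv]
  refine ⟨fun u => (hasDerivAt_smoothPosPart u).differentiableAt, ?_⟩
  have : deriv smoothPosPart = smoothPosPartDeriv :=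
    funext fun u => (hasDerivAt_smoothPosPart u).deriv
  rw [this]
  unfold smoothPosPartDeriv
  fun_prop

theorem smoothPosPartDeriv_nonneg (u : ℝ) : 0 ≤ smoothPosPartDeriv u := by
  unfold smoothPosPartDeriv
  have : max (u - 1) 0 ≤ max u 0 := max_le_max_right _ (by linarith)
  linarith

theorem smoothPosPartDeriv_le_one (u : ℝ) : smoothPosPartDeriv u ≤ 1 := by
  unfold smoothPosPartDeriv
  have : max u 0 ≤ max (u - 1) 0 + 1 := max_le (by linarith [le_max_left (u - 1) 0])
    (by linarith [le_max_right (u - 1) 0])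
  linarith

theorem smoothPosPartDeriv_of_nonpos {u : ℝ} (hu : u ≤ 0) : smoothPosPartDeriv u = 0 := by
  simp [smoothPosPartDeriv, max_eq_right hu, max_eq_right (show u - 1 ≤ 0 by linarith)]

theorem smoothPosPartDeriv_of_one_le {u : ℝ} (hu : 1 ≤ u) : smoothPosPartDeriv u = 1 := by
  simp [smoothPosPartDeriv, max_eq_left (show 0 ≤ u by linarith),
    max_eq_left (show 0 ≤ u - 1 by linarith)]

theorem smoothPosPart_of_nonpos {u : ℝ} (hu : u ≤ 0) : smoothPosPart u = 0 := by
  simp [smoothPosPart, max_eq_right hu, max_eq_right (show u - 1 ≤ 0 by linarith)]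

theorem smoothPosPart_of_one_le {u : ℝ} (hu : 1 ≤ u) : smoothPosPart u = u - 1 / 2 := by
  rw [smoothPosPart, max_eq_left (show 0 ≤ u by linarith),
    max_eq_left (show 0 ≤ u - 1 by linarith)]
  ring

theorem smoothPosPart_nonneg (u : ℝ) : 0 ≤ smoothPosPart u := by
  unfold smoothPosPart
  have h1 : max (u - 1) 0 ≤ max u 0 := max_le_max_right _ (by linarith)
  have h2 := pow_le_pow_left₀ (le_max_right (u - 1) 0) h1 2
  linarith

theorem smoothPosPart_le_max (u : ℝ) : smoothPosPart u ≤ max u 0 := by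
  rcases le_total u 0 with h | h
  · simp [smoothPosPart_of_nonpos h]
  rcases le_total 1 u with h1 | h1
  · rw [smoothPosPart_of_one_le h1, max_eq_left h]; linarith
  · rw [smoothPosPart, max_eq_left h, max_eq_right (by linarith : u - 1 ≤ 0)]
    nlinarith

theorem sub_half_le_smoothPosPart (u : ℝ) : u - 1 / 2 ≤ smoothPosPart u := by
  rcases le_total u 0 with h | h
  · rw [smoothPosPart_of_nonpos h]; linarith
  rcases le_total 1 u with h1 | h1
  · rw [smoothPosPart_of_one_le h1]
  · rw [smoothPosPart, max_eq_left h, max_eq_right (by linarith : u - 1 ≤ 0)]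
    nlinarith [sq_nonneg (u - 1)]

/-! ### Superlinear convex functions and the Legendre cost -/

open GibbsEntropy

/-- A `C¹` convex function on Euclidean space of superlinear growth. -/
structure SuperlinearConvex {n : ℕ} (φ : EuclideanSpace ℝ (Fin n) → ℝ) : Prop where
  contDiff : ContDiff ℝ 1 φ
  convexOn : ConvexOn ℝ Set.univ φ
  tendsto : Tendsto (fun x => φ x / ‖x‖) (cocompact (EuclideanSpace ℝ (Fin n))) atTop

/-- The function `x · p - φ^*(∇φ(x)) + φ^*(∇φ(x) - p)`. -/
noncomputable def legendreCost {n : ℕ} (φ : EuclideanSpace ℝ (Fin n) → ℝ)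
    (x p : EuclideanSpace ℝ (Fin n)) : ℝ :=
  inner ℝ x p - legendre φ (gradient φ x) + legendre φ (gradient φ x - p)

theorem energyDensity_eq_legendreCost {n : ℕ} (φ g : EuclideanSpace ℝ (Fin n) → ℝ)
    (x : EuclideanSpace ℝ (Fin n)) :
    energyDensity φ g x = legendreCost φ x (gradient g x) := rfl

theorem exists_mul_norm_sub_le {n : ℕ} {φ : EuclideanSpace ℝ (Fin n) → ℝ} (hc : Continuous φ)
    (hs : Tendsto (fun x => φ x / ‖x‖) (cocompact (EuclideanSpace ℝ (Fin n))) atTop) (A : ℝ) :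
    ∃ C, ∀ x, A * ‖x‖ - C ≤ φ x := by
  obtain ⟨K, hK, hK'⟩ := mem_cocompact.1 (hs.eventually_ge_atTop A)
  have hcont : Continuous fun z : EuclideanSpace ℝ (Fin n) => A * ‖z‖ - φ z := by fun_prop
  obtain ⟨M, hM⟩ := hK.bddAbove_image hcont.continuousOn
  refine ⟨max (max M 0) (-φ 0), fun z => ?_⟩
  by_cases hz : z ∈ K
  · have h1 : A * ‖z‖ - φ z ≤ M := hM ⟨z, hz, rfl⟩
    have h2 := (le_max_left M 0).trans (le_max_left (max M 0) (-φ 0))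
    linarith
  · have h1 : A ≤ φ z / ‖z‖ := hK' hz
    rcases eq_or_ne z 0 with rfl | h0
    · have := le_max_right (max M 0) (-φ 0)
      simp only [norm_zero, mul_zero]
      linarith
    · rw [le_div_iff₀ (norm_pos_iff.2 h0)] at h1
      have h2 := (le_max_right M 0).trans (le_max_left (max M 0) (-φ 0))
      linarith

/-- Since log(1 + r) ≤ r, the slope n + 1 bounds e^{-φ} by a multiple of (1 + ‖x‖)^{-(n+1)},
integrable in dimension n. -/
theorem integrable_exp_neg_of_mul_norm_sub_le {n : ℕ} {φ : EuclideanSpace ℝ (Fin n) → ℝ}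
    (hc : AEMeasurable φ) {C : ℝ} (h : ∀ x, (n + 1 : ℝ) * ‖x‖ - C ≤ φ x) :
    Integrable fun x => Real.exp (-φ x) := by
  have h1 : Integrable fun x : EuclideanSpace ℝ (Fin n) => (1 + ‖x‖) ^ (-(n + 1 : ℝ)) :=
    integrable_one_add_norm (by simp)
  refine (h1.const_mul (Real.exp C)).mono' (Real.measurable_exp.comp_aemeasurable hc.neg).aestronglyMeasurable
    (Eventually.of_forall fun x => ?_)
  rw [Real.norm_eq_abs, Real.abs_exp]
  have h2 : 0 < 1 + ‖x‖ := by positivity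
  have h3 : Real.log (1 + ‖x‖) ≤ ‖x‖ := by
    have := Real.log_le_sub_one_of_pos h2
    linarith
  rw [Real.rpow_def_of_pos h2, ← Real.exp_add]
  refine Real.exp_le_exp.2 ?_
  have h4 : (n + 1 : ℝ) * Real.log (1 + ‖x‖) ≤ (n + 1 : ℝ) * ‖x‖ := by gcongr
  linarith [h x]

/-- A convex differentiable function lies above its tangent planes. -/
theorem ConvexOn.add_inner_gradient_le {V : Type*} [NormedAddCommGroup V] [InnerProductSpace ℝ V]
    [CompleteSpace V] {φ : V → ℝ} (h : ConvexOn ℝ Set.univ φ) {x : V}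
    (hd : DifferentiableAt ℝ φ x) (y : V) :
    φ x + inner ℝ (gradient φ x) (y - x) ≤ φ y := by
  have h1 : HasDerivAt (fun s : ℝ => φ (x + s • (y - x))) (inner ℝ (gradient φ x) (y - x)) 0 := by
    have h2 : HasDerivAt (fun s : ℝ => x + s • (y - x)) (y - x) 0 := by
      simpa using ((hasDerivAt_id (0 : ℝ)).smul_const (y - x)).const_add x
    have h3 : HasFDerivAt φ (InnerProductSpace.toDual ℝ V (gradient φ x)) (x + (0 : ℝ) • (y - x)) := by
      simpa using hd.hasGradientAt.hasFDerivAt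
    exact h3.comp_hasDerivAt (0 : ℝ) h2
  have hconv : ConvexOn ℝ Set.univ (fun s : ℝ => φ (x + s • (y - x))) := by
    have := h.comp_affineMap (AffineMap.lineMap x y : ℝ →ᵃ[ℝ] V)
    refine this.congr fun s _ => ?_
    simp [AffineMap.lineMap_apply, add_comm]
  have h4 := hconv.le_slope_of_hasDerivAt (Set.mem_univ _) (Set.mem_univ _) zero_lt_one h1
  simp only [slope_def_field, one_smul, zero_smul, add_zero, add_sub_cancel, sub_zero, div_one] at h4
  linarith

namespace SuperlinearConvex

variable {n : ℕ} {φ : EuclideanSpace ℝ (Fin n) → ℝ}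

theorem continuous (h : SuperlinearConvex φ) : Continuous φ := h.contDiff.continuous

theorem add_inner_gradient_le (h : SuperlinearConvex φ) (x y : EuclideanSpace ℝ (Fin n)) :
    φ x + inner ℝ (gradient φ x) (y - x) ≤ φ y :=
  h.convexOn.add_inner_gradient_le (h.contDiff.differentiable one_ne_zero x) y

theorem inner_sub_le_legendre (h : SuperlinearConvex φ) (y z : EuclideanSpace ℝ (Fin n)) :
    inner ℝ y z - φ z ≤ legendre φ y :=
  le_ciSup (legendre_bddAbove φ h.continuous h.tendsto y) z

/-- By the tangent plane inequality at x, the supremum is attained at x. -/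
theorem legendre_gradient (h : SuperlinearConvex φ) (x : EuclideanSpace ℝ (Fin n)) :
    legendre φ (gradient φ x) = inner ℝ (gradient φ x) x - φ x := by
  refine le_antisymm (ciSup_le fun z => ?_) (h.inner_sub_le_legendre _ x)
  have := h.add_inner_gradient_le x z
  rw [inner_sub_right] at this
  linarith

theorem convexOn_legendre (h : SuperlinearConvex φ) : ConvexOn ℝ Set.univ (legendre φ) := by
  refine ⟨convex_univ, fun p _ q _ a b ha hb hab => ciSup_le fun z => ?_⟩
  have h1 := mul_le_mul_of_nonneg_left (h.inner_sub_le_legendre p z) ha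
  have h2 := mul_le_mul_of_nonneg_left (h.inner_sub_le_legendre q z) hb
  rw [inner_add_left, real_inner_smul_left, real_inner_smul_left, smul_eq_mul, smul_eq_mul]
  have h3 : φ z = a * φ z + b * φ z := by rw [← add_mul, hab, one_mul]
  linarith

theorem continuous_legendre (h : SuperlinearConvex φ) : Continuous (legendre φ) :=
  h.convexOn_legendre.locallyLipschitz.continuous

theorem convexOn_legendreCost (h : SuperlinearConvex φ) (x : EuclideanSpace ℝ (Fin n)) :
    ConvexOn ℝ Set.univ (legendreCost φ x) := by
  refine ⟨convex_univ, fun p _ q _ a b ha hb hab => ?_⟩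
  have h1 := h.convexOn_legendre.2 (Set.mem_univ (gradient φ x - p))
    (Set.mem_univ (gradient φ x - q)) ha hb hab
  have h2 : a • (gradient φ x - p) + b • (gradient φ x - q) = gradient φ x - (a • p + b • q) := by
    rw [smul_sub, smul_sub, sub_add_sub_comm, ← add_smul, hab, one_smul]
  rw [h2] at h1
  unfold legendreCost
  simp only [smul_eq_mul] at h1 ⊢
  rw [inner_add_right, real_inner_smul_right, real_inner_smul_right]
  have h3 : legendre φ (gradient φ x)
      = a * legendre φ (gradient φ x) + b * legendre φ (gradient φ x) := by
    rw [← add_mul, hab, one_mul]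
  linarith

theorem legendreCost_zero (x : EuclideanSpace ℝ (Fin n)) : legendreCost φ x 0 = 0 := by
  simp [legendreCost]

/-- Fenchel–Young: y is one competitor in φ*(∇φ(x) - p). Equivalently, p·(x - y) is at most the cost
plus the Bregman divergence of φ from x to y. -/
theorem le_legendreCost (h : SuperlinearConvex φ) (x p y : EuclideanSpace ℝ (Fin n)) :
    inner ℝ p (x - y) + φ x - φ y + inner ℝ (gradient φ x) (y - x) ≤ legendreCost φ x p := by
  have h1 := h.inner_sub_le_legendre (gradient φ x - p) y
  rw [legendreCost, h.legendre_gradient, inner_sub_right, inner_sub_right, real_inner_comm]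
  rw [inner_sub_left] at h1
  linarith

theorem legendreCost_nonneg (h : SuperlinearConvex φ) (x p : EuclideanSpace ℝ (Fin n)) :
    0 ≤ legendreCost φ x p := by
  simpa using h.le_legendreCost x p x

theorem legendreCost_smul_le (h : SuperlinearConvex φ) (x p : EuclideanSpace ℝ (Fin n)) {s : ℝ}
    (h0 : 0 ≤ s) (h1 : s ≤ 1) : legendreCost φ x (s • p) ≤ s * legendreCost φ x p := by
  have := (h.convexOn_legendreCost x).2 (Set.mem_univ p) (Set.mem_univ 0) h0
    (sub_nonneg.2 h1) (by ring)
  simpa [legendreCost_zero] using this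

theorem legendreCost_gradient (h : SuperlinearConvex φ) (x : EuclideanSpace ℝ (Fin n)) :
    legendreCost φ x (gradient φ x) = φ x + legendre φ 0 := by
  rw [legendreCost, h.legendre_gradient, sub_self, real_inner_comm]
  ring

theorem neg_legendre_zero_le (h : SuperlinearConvex φ) (x : EuclideanSpace ℝ (Fin n)) :
    0 ≤ φ x + legendre φ 0 := by
  rw [← h.legendreCost_gradient]
  exact h.legendreCost_nonneg _ _

theorem integrable_exp_neg_add (h : SuperlinearConvex φ) {U : EuclideanSpace ℝ (Fin n) → ℝ}
    (hU : AEMeasurable U) {B : ℝ} (hB : ∀ x, |U x| ≤ B) :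
    Integrable fun x => Real.exp (-(φ x + U x)) := by
  obtain ⟨C, hC⟩ := exists_mul_norm_sub_le h.continuous h.tendsto (n + 1 : ℝ)
  refine integrable_exp_neg_of_mul_norm_sub_le (C := C + B)
    (h.continuous.measurable.aemeasurable.add hU) fun x => ?_
  have := (abs_le.1 (hB x)).1
  linarith [hC x]

theorem integrable_exp_neg (h : SuperlinearConvex φ) : Integrable fun x => Real.exp (-φ x) := by
  simpa using h.integrable_exp_neg_add (U := 0) aemeasurable_zero (B := 0) (by simp)

/-- With u = φ + φ*(0), the bound u ≤ 2e^{u/2} leaves a multiple of e^{-φ/2}; hence the doubled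
slope 2(n + 1). -/
theorem integrable_add_const_mul_exp_neg (h : SuperlinearConvex φ) :
    Integrable fun x => (φ x + legendre φ 0) * Real.exp (-φ x) := by
  have hc := h.continuous
  obtain ⟨C, hC⟩ := exists_mul_norm_sub_le h.continuous h.tendsto (2 * (n + 1) : ℝ)
  have h1 := integrable_exp_neg_of_mul_norm_sub_le (φ := fun x => φ x / 2) (C := C / 2)
    (by fun_prop) fun x => by linarith [hC x]
  refine (h1.const_mul (2 * Real.exp (legendre φ 0 / 2))).mono'
    (by fun_prop) (Eventually.of_forall fun x => ?_)
  rw [Real.norm_eq_abs, abs_mul, Real.abs_exp, abs_of_nonneg (h.neg_legendre_zero_le x)]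
  have h2 : (φ x + legendre φ 0) / 2 ≤ Real.exp ((φ x + legendre φ 0) / 2) := by
    linarith [Real.add_one_le_exp ((φ x + legendre φ 0) / 2)]
  calc (φ x + legendre φ 0) * Real.exp (-φ x)
      ≤ (2 * Real.exp ((φ x + legendre φ 0) / 2)) * Real.exp (-φ x) := by gcongr; linarith
    _ = _ := by
      rw [mul_assoc, mul_assoc, ← Real.exp_add, ← Real.exp_add]
      congr 2
      ring

theorem continuous_gradient {g : EuclideanSpace ℝ (Fin n) → ℝ} (hg : ContDiff ℝ 1 g) :
    Continuous (gradient g) :=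
  (InnerProductSpace.toDual ℝ _).symm.continuous.comp (hg.continuous_fderiv one_ne_zero)

theorem continuous_energyDensity (h : SuperlinearConvex φ) {g : EuclideanSpace ℝ (Fin n) → ℝ}
    (hg : ContDiff ℝ 1 g) : Continuous (energyDensity φ g) := by
  have h1 := continuous_gradient hg
  have h2 := continuous_gradient h.contDiff
  have h3 := h.continuous_legendre
  unfold energyDensity
  fun_prop

end SuperlinearConvex

/-! ### Differentiating Prékopa–Leindler at t = 0 -/

/-- A compactly supported `C¹` function is uniformly Fréchet differentiable. -/
theorem HasCompactSupport.exists_forall_sub_le_inner_gradient_add {V : Type*}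
    [NormedAddCommGroup V] [InnerProductSpace ℝ V] [CompleteSpace V] {g : V → ℝ}
    (hs : HasCompactSupport g) (hg : ContDiff ℝ 1 g) {w : ℝ} (hw : 0 < w) :
    ∃ δ > 0, ∀ z x, ‖x - z‖ < δ → g x - g z ≤ inner ℝ (gradient g z) (x - z) + w * ‖x - z‖ := by
  have hu := (hs.fderiv ℝ).uniformContinuous_of_continuous (hg.continuous_fderiv one_ne_zero)
  obtain ⟨δ, hδ, h⟩ := Metric.uniformContinuous_iff.1 hu w hw
  refine ⟨δ, hδ, fun z x hx => ?_⟩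
  have h1 := (convex_ball z δ).norm_image_sub_le_of_norm_fderiv_le' (𝕜 := ℝ) (f := g) (C := w)
    (φ := fderiv ℝ g z) (x := z) (y := x)
    (fun y _ => hg.differentiable one_ne_zero y)
    (fun y hy => by
      rw [← dist_eq_norm]
      exact (h (Metric.mem_ball.1 hy)).le)
    (Metric.mem_ball_self hδ) (by rwa [Metric.mem_ball, dist_eq_norm])
  have h2 : inner ℝ (gradient g z) (x - z) = fderiv ℝ g z (x - z) := by simp
  rw [h2]
  have h3 := (Real.le_norm_self _).trans h1
  linarith

namespace SuperlinearConvex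

variable {n : ℕ} {φ : EuclideanSpace ℝ (Fin n) → ℝ}

/-- The Bregman divergence based at points of a compact set has superlinear growth. -/
theorem exists_mul_norm_le_bregman (h : SuperlinearConvex φ) {K : Set (EuclideanSpace ℝ (Fin n))}
    (hK : IsCompact K) {L : ℝ} (hL : 0 ≤ L) :
    ∃ R > 0, ∀ z ∈ K, ∀ y, R ≤ ‖y - z‖ →
      L * ‖y - z‖ ≤ φ y - φ z - inner ℝ (gradient φ z) (y - z) := by
  obtain ⟨M₁, h1⟩ := hK.exists_bound_of_continuousOn h.continuous.continuousOn
  obtain ⟨M₂, h2⟩ := hK.exists_bound_of_continuousOn (continuous_gradient h.contDiff).continuousOn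
  obtain ⟨M₃, h3⟩ := hK.exists_bound_of_continuousOn continuous_id.continuousOn
  obtain ⟨C, hC⟩ := exists_mul_norm_sub_le h.continuous h.tendsto (L + |M₂| + 1)
  -- With r = ‖y - z‖, the bounds below make the divergence at least L r + r - ((L + |M₂| + 1) M₃ +
  -- C + M₁); the maximum with 1 keeps R positive.
  refine ⟨max 1 ((L + |M₂| + 1) * M₃ + C + M₁), by positivity, fun z hz y hy => ?_⟩
  have e1 := (Real.le_norm_self _).trans (h1 z hz)
  have e2 := (h2 z hz).trans (le_abs_self _)
  have e3 : ‖z‖ ≤ M₃ := h3 z hz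
  have e4 := real_inner_le_norm (gradient φ z) (y - z)
  have e5 : ‖gradient φ z‖ * ‖y - z‖ ≤ |M₂| * ‖y - z‖ := by gcongr
  have e6 : ‖y - z‖ - M₃ ≤ ‖y‖ := by linarith [norm_sub_le y z]
  have e7 : (L + |M₂| + 1) * (‖y - z‖ - M₃) ≤ (L + |M₂| + 1) * ‖y‖ := by gcongr
  have e8 := (le_max_right 1 ((L + |M₂| + 1) * M₃ + C + M₁)).trans hy
  nlinarith [hC y]

/-- This is the pointwise hypothesis of Prékopa–Leindler, with t independent of the points. The
Jensen gap of φ dominates t times the divergence from z to y. For y near z, uniform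
differentiability of g and Fenchel–Young suffice; for y far from z, the divergence alone beats the
Lipschitz bound on g. -/
theorem exists_forall_sub_le_of_hasCompactSupport (h : SuperlinearConvex φ)
    {g : EuclideanSpace ℝ (Fin n) → ℝ} (hg : ContDiff ℝ 1 g) (hs : HasCompactSupport g)
    (hg0 : ∀ x, g x ≤ 0) {ε : ℝ} (hε : 0 < ε) :
    ∃ t₀ > 0, t₀ < 1 ∧ ∀ t, 0 < t → t < t₀ → ∀ x y z, z = (1 - t) • x + t • y →
      (1 - t) * (g x - g z) ≤
        (1 - t) * φ x + t * φ y - φ z + t * (energyDensity φ g z + ε) := by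
  obtain ⟨L, hL⟩ := hg.lipschitzWith_of_hasCompactSupport hs one_ne_zero
  obtain ⟨R, hR, hB⟩ := h.exists_mul_norm_le_bregman hs L.2
  obtain ⟨δ, hδ, hd⟩ := hs.exists_forall_sub_le_inner_gradient_add hg (div_pos hε hR)
  -- As (1 - t)‖x - z‖ = t‖y - z‖ and 1 - t > 1/2, having ‖y - z‖ < R forces ‖x - z‖ < 2tR < δ.
  refine ⟨min (1 / 2) (δ / (2 * R)), by positivity, (min_le_left _ _).trans_lt (by norm_num), ?_⟩
  intro t ht htt x y z hz
  have ht2 : t < 1 / 2 := htt.trans_le (min_le_left _ _)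
  have htδ : t < δ / (2 * R) := htt.trans_le (min_le_right _ _)
  have h1t : 0 < 1 - t := by linarith
  have hE : inner ℝ (gradient g z) (z - y) + φ z - φ y + inner ℝ (gradient φ z) (y - z)
      ≤ energyDensity φ g z := h.le_legendreCost z (gradient g z) y
  have hE0 : 0 ≤ energyDensity φ g z := h.legendreCost_nonneg _ _
  have hxz : (1 - t) • (x - z) = t • (z - y) := by
    rw [hz]
    module
  have hn : (1 - t) * ‖x - z‖ = t * ‖y - z‖ := by
    have := congrArg norm hxz
    rwa [norm_smul, norm_smul, Real.norm_of_nonneg h1t.le, Real.norm_of_nonneg ht.le,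
      norm_sub_rev z y] at this
  have hin : ∀ p : EuclideanSpace ℝ (Fin n),
      (1 - t) * inner ℝ p (x - z) = t * inner ℝ p (z - y) := by
    intro p
    rw [← real_inner_smul_right, hxz, real_inner_smul_right]
  have hneg : ∀ p : EuclideanSpace ℝ (Fin n), inner ℝ p (z - y) = - inner ℝ p (y - z) := by
    intro p
    rw [← inner_neg_right, neg_sub]
  have hD : t * (φ y - φ z - inner ℝ (gradient φ z) (y - z))
      ≤ (1 - t) * φ x + t * φ y - φ z := by
    have h1 := mul_le_mul_of_nonneg_left (h.add_inner_gradient_le z x) h1t.le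
    have h2 := hin (gradient φ z)
    rw [hneg] at h2
    linarith
  have hB0 : 0 ≤ φ y - φ z - inner ℝ (gradient φ z) (y - z) := by
    linarith [h.add_inner_gradient_le z y]
  have hD0 : 0 ≤ (1 - t) * φ x + t * φ y - φ z := (mul_nonneg ht.le hB0).trans hD
  have htE : 0 ≤ t * (energyDensity φ g z + ε) := by positivity
  by_cases hzK : z ∈ tsupport g
  · rcases le_or_gt R ‖y - z‖ with hr | hr
    · have h1 : g x - g z ≤ L * ‖x - z‖ := by
        have := hL.dist_le_mul x z
        rw [dist_eq_norm, dist_eq_norm] at this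
        exact (Real.le_norm_self _).trans this
      have h2 := mul_le_mul_of_nonneg_left h1 h1t.le
      have h3 := mul_le_mul_of_nonneg_left (hB z hzK y hr) ht.le
      have h4 : (1 - t) * (L * ‖x - z‖) = t * (L * ‖y - z‖) := by linear_combination (L : ℝ) * hn
      simp only [NNReal.val_eq_coe] at h3
      linarith
    · have h1 : ‖x - z‖ < δ := by
        rw [lt_div_iff₀ (by positivity)] at htδ
        nlinarith [norm_nonneg (x - z), norm_nonneg (y - z)]
      have h2 := mul_le_mul_of_nonneg_left (hd z x h1) h1t.le
      have h3 := hin (gradient g z)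
      have h4 : (1 - t) * (ε / R * ‖x - z‖) ≤ t * ε := by
        have : (1 - t) * (ε / R * ‖x - z‖) = t * (ε / R * ‖y - z‖) := by
          linear_combination (ε / R) * hn
        rw [this]
        refine mul_le_mul_of_nonneg_left ?_ ht.le
        calc ε / R * ‖y - z‖ ≤ ε / R * R := by gcongr
          _ = ε := by field_simp
      have h5 := mul_le_mul_of_nonneg_left hE ht.le
      linarith
  -- Off the support of g, the sign of g makes the left side nonpositive; no compactness bound in z
  -- is needed.
  · have h1 : g z = 0 := image_eq_zero_of_notMem_tsupport hzK
    have h2 := mul_nonpos_of_nonneg_of_nonpos h1t.le (hg0 x)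
    rw [h1, sub_zero]
    linarith

/-- Off `tsupport g` both g and ∇g vanish, so the continuous difference has compact support. -/
theorem exists_abs_energyDensity_sub_le (h : SuperlinearConvex φ)
    {g : EuclideanSpace ℝ (Fin n) → ℝ} (hg : ContDiff ℝ 1 g) (hs : HasCompactSupport g) :
    ∃ W, ∀ x, |energyDensity φ g x - g x| ≤ W := by
  refine Continuous.bounded_above_of_compact_support
    ((h.continuous_energyDensity hg).sub hg.continuous) (hs.mono' fun x hx => ?_)
  by_contra hx'
  refine hx ?_
  have h1 : g x = 0 := image_eq_zero_of_notMem_tsupport hx'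
  have h2 : gradient g x = 0 := by
    have : fderiv ℝ g x = 0 := by
      by_contra h3
      exact hx' (support_fderiv_subset ℝ h3)
    simp [gradient, this]
  change energyDensity φ g x - g x = 0
  rw [energyDensity_eq_legendreCost, h2, h1, legendreCost_zero, sub_zero]

/-- The logarithmic Sobolev inequality for the measure of density `exp (-φ)` and a nonpositive
compactly supported function. -/
theorem mul_log_le_integral_of_hasCompactSupport (h : SuperlinearConvex φ)
    {g : EuclideanSpace ℝ (Fin n) → ℝ} (hg : ContDiff ℝ 1 g) (hs : HasCompactSupport g)
    (hg0 : ∀ x, g x ≤ 0) :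
    (∫ x, Real.exp (g x - φ x)) *
        Real.log ((∫ x, Real.exp (-φ x)) / ∫ x, Real.exp (g x - φ x)) ≤
      ∫ x, (energyDensity φ g x - g x) * Real.exp (g x - φ x) := by
  obtain ⟨W, hW⟩ := h.exists_abs_energyDensity_sub_le hg hs
  have hW0 : 0 ≤ W := (abs_nonneg _).trans (hW 0)
  have hφc := h.continuous
  have hgc := hg.continuous
  have hEc := h.continuous_energyDensity hg
  have hiφ := h.integrable_exp_neg
  have hig : Integrable fun x => Real.exp (g x - φ x) := by
    refine hiφ.mono' (by fun_prop) (Eventually.of_forall fun x => ?_)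
    rw [Real.norm_eq_abs, Real.abs_exp]
    exact Real.exp_le_exp.2 (by linarith [hg0 x])
  have hiE : Integrable fun x => (energyDensity φ g x - g x) * Real.exp (g x - φ x) :=
    hig.bdd_mul (by fun_prop) (Eventually.of_forall hW)
  set M := ∫ x, Real.exp (g x - φ x) with hM
  set Z := ∫ x, Real.exp (-φ x) with hZ
  set J := ∫ x, (energyDensity φ g x - g x) * Real.exp (g x - φ x) with hJ
  have hM0 : 0 < M := integral_exp_pos hig
  have hZ0 : 0 < Z := integral_exp_pos hiφ
  have key : ∀ ε > 0, ε ≤ 1 → M * Real.log (Z / M) ≤ J + ε * (M + (W + 1) ^ 2 * M) := by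
    intro ε hε hε1
    obtain ⟨t₀, ht₀, ht₀1, hmain⟩ := h.exists_forall_sub_le_of_hasCompactSupport hg hs hg0 hε
    -- t < t₀ gives the pointwise inequality, t < ε absorbs the second-order error, and t(W + 1) ≤ 1
    -- permits the quadratic bound on the exponential.
    obtain ⟨t, ht, htlt⟩ := exists_between (show (0 : ℝ) < min t₀ (min ε (1 / (W + 1))) by positivity)
    have htt₀ : t < t₀ := htlt.trans_le (min_le_left _ _)
    have htε : t < ε := htlt.trans_le ((min_le_right _ _).trans (min_le_left _ _))
    have htW : t * (W + 1) ≤ 1 := by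
      have := htlt.trans_le ((min_le_right _ _).trans (min_le_right _ _))
      rw [lt_div_iff₀ (by positivity)] at this
      exact this.le
    have h1t : 0 < 1 - t := by linarith
    set w : EuclideanSpace ℝ (Fin n) → ℝ := fun x => energyDensity φ g x - g x + ε with hw
    have hwc : Continuous w := by fun_prop
    have hwW : ∀ x, |w x| ≤ W + 1 := fun x =>
      (abs_add_le _ _).trans (add_le_add (hW x) (by rwa [abs_of_pos hε]))
    have hexp : ∀ x, Real.exp (t * w x) ≤ 1 + t * w x + (t * (W + 1)) ^ 2 := by
      intro x
      have h1 : |t * w x| ≤ t * (W + 1) := by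
        rw [abs_mul, abs_of_pos ht]
        exact mul_le_mul_of_nonneg_left (hwW x) ht.le
      have h2 := (abs_le.1 (Real.abs_exp_sub_one_sub_id_le (h1.trans htW))).2
      have h3 : (t * w x) ^ 2 ≤ (t * (W + 1)) ^ 2 := sq_le_sq' (abs_le.1 h1).1 (abs_le.1 h1).2
      linarith
    have hiw : Integrable fun x => w x * Real.exp (g x - φ x) :=
      hig.bdd_mul (by fun_prop) (Eventually.of_forall hwW)
    have hirhs : Integrable fun x =>
        (1 + t * w x + (t * (W + 1)) ^ 2) * Real.exp (g x - φ x) := by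
      have := (hig.add (hiw.const_mul t)).add (hig.const_mul ((t * (W + 1)) ^ 2))
      refine this.congr (Eventually.of_forall fun x => ?_)
      simp only [Pi.add_apply]
      ring
    have hiH : Integrable fun x => Real.exp (t * w x) * Real.exp (g x - φ x) := by
      refine hirhs.mono' (by fun_prop) (Eventually.of_forall fun x => ?_)
      rw [Real.norm_eq_abs, abs_mul, Real.abs_exp, Real.abs_exp]
      gcongr
      exact hexp x
    have hPL := prekopaLeindler_euclideanSpace ht (by linarith : t < 1) n
      (fun x => ENNReal.ofReal (Real.exp (g x - φ x))) (fun x => ENNReal.ofReal (Real.exp (-φ x)))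
      (fun x => ENNReal.ofReal (Real.exp (t * w x) * Real.exp (g x - φ x)))
      (by fun_prop) (by fun_prop) (by fun_prop) (by
        intro x y
        rw [ENNReal.ofReal_rpow_of_pos (Real.exp_pos _), ENNReal.ofReal_rpow_of_pos (Real.exp_pos _),
          ← ENNReal.ofReal_mul (by positivity), ← Real.exp_mul, ← Real.exp_mul, ← Real.exp_add,
          ← Real.exp_add]
        refine ENNReal.ofReal_le_ofReal (Real.exp_le_exp.2 ?_)
        have := hmain t ht htt₀ x y _ rfl
        simp only [hw]
        linarith)
    rw [← ofReal_integral_eq_lintegral_ofReal hig (Eventually.of_forall fun x => by positivity),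
      ← ofReal_integral_eq_lintegral_ofReal hiφ (Eventually.of_forall fun x => by positivity),
      ← ofReal_integral_eq_lintegral_ofReal hiH (Eventually.of_forall fun x => by positivity),
      ENNReal.ofReal_rpow_of_pos hM0, ENNReal.ofReal_rpow_of_pos hZ0,
      ← ENNReal.ofReal_mul (by positivity),
      ENNReal.ofReal_le_ofReal_iff (integral_nonneg fun x => by positivity)] at hPL
    have h1 : M ^ (1 - t) * Z ^ t = M * Real.exp (t * Real.log (Z / M)) := by
      have e : Real.log M * (1 - t) + Real.log Z * t =
          Real.log M + t * (Real.log Z - Real.log M) := by ring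
      rw [Real.rpow_def_of_pos hM0, Real.rpow_def_of_pos hZ0, Real.log_div hZ0.ne' hM0.ne',
        ← Real.exp_add, e, Real.exp_add, Real.exp_log hM0]
    -- Both sides of Prékopa–Leindler are now reduced to M plus t times a first-order term, so M
    -- cancels and t divides out.
    have h2 : M * (1 + t * Real.log (Z / M)) ≤ M * Real.exp (t * Real.log (Z / M)) := by
      refine mul_le_mul_of_nonneg_left ?_ hM0.le
      linarith [Real.add_one_le_exp (t * Real.log (Z / M))]
    have h3 : ∫ x, Real.exp (t * w x) * Real.exp (g x - φ x) ≤
        ∫ x, (1 + t * w x + (t * (W + 1)) ^ 2) * Real.exp (g x - φ x) :=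
      integral_mono hiH hirhs fun x => mul_le_mul_of_nonneg_right (hexp x) (Real.exp_pos _).le
    have h4 : ∫ x, (1 + t * w x + (t * (W + 1)) ^ 2) * Real.exp (g x - φ x) =
        M + t * (J + ε * M) + (t * (W + 1)) ^ 2 * M := by
      have e : ∀ x, (1 + t * w x + (t * (W + 1)) ^ 2) * Real.exp (g x - φ x) =
          (1 + t * ε + (t * (W + 1)) ^ 2) * Real.exp (g x - φ x) +
            t * ((energyDensity φ g x - g x) * Real.exp (g x - φ x)) := by
        intro x
        simp only [hw]
        ring
      simp_rw [e]
      rw [integral_add (hig.const_mul _) (hiE.const_mul _), integral_const_mul, integral_const_mul]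
      ring
    have h5 : t * (M * Real.log (Z / M)) ≤ t * (J + ε * M + t * ((W + 1) ^ 2 * M)) := by
      have := (h1 ▸ h2).trans (hPL.trans (h3.trans_eq h4))
      linarith
    have h6 := le_of_mul_le_mul_left h5 ht
    have h7 : t * ((W + 1) ^ 2 * M) ≤ ε * ((W + 1) ^ 2 * M) := by gcongr
    linarith
  have hlim : Tendsto (fun ε : ℝ => J + ε * (M + (W + 1) ^ 2 * M)) (nhdsWithin 0 (Set.Ioi 0))
      (nhds J) := by
    have : Continuous fun ε : ℝ => J + ε * (M + (W + 1) ^ 2 * M) := by fun_prop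
    have h1 := this.tendsto 0
    simp only [zero_mul, add_zero] at h1
    exact h1.mono_left nhdsWithin_le_nhds
  refine ge_of_tendsto hlim ?_
  filter_upwards [Ioo_mem_nhdsGT zero_lt_one] with ε hε
  exact key ε hε.1 hε.2.le

end SuperlinearConvex

/-! ### Gibbs measures and their comparison -/

section gibbs

variable {n : ℕ} {Φ Ψ : EuclideanSpace ℝ (Fin n) → ℝ}

theorem toReal_gibbs_density (Φ : EuclideanSpace ℝ (Fin n) → ℝ) (x : EuclideanSpace ℝ (Fin n)) :
    (ENNReal.ofReal (Real.exp (-Φ x) / ∫ z, Real.exp (-Φ z))).toReal =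
      Real.exp (-Φ x) / ∫ z, Real.exp (-Φ z) :=
  ENNReal.toReal_ofReal
    (div_nonneg (Real.exp_pos _).le (integral_nonneg fun _ => (Real.exp_pos _).le))

theorem aemeasurable_gibbs_density (h : Integrable fun x => Real.exp (-Φ x)) :
    AEMeasurable fun x => ENNReal.ofReal (Real.exp (-Φ x) / ∫ z, Real.exp (-Φ z)) :=
  (h.aemeasurable.div_const _).ennreal_ofReal

theorem isProbabilityMeasure_gibbs (h : Integrable fun x => Real.exp (-Φ x)) :
    IsProbabilityMeasure (gibbs Φ) := by
  refine ⟨?_⟩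
  rw [gibbs, withDensity_apply _ MeasurableSet.univ, Measure.restrict_univ,
    ← ofReal_integral_eq_lintegral_ofReal (h.div_const _) (Eventually.of_forall fun x =>
      div_nonneg (Real.exp_pos _).le (integral_nonneg fun _ => (Real.exp_pos _).le)),
    integral_div, div_self (integral_exp_pos h).ne', ENNReal.ofReal_one]

theorem integrable_gibbs_iff (h : Integrable fun x => Real.exp (-Φ x))
    {F : EuclideanSpace ℝ (Fin n) → ℝ} :
    Integrable F (gibbs Φ) ↔ Integrable fun x => F x * Real.exp (-Φ x) := by
  rw [gibbs, integrable_withDensity_iff_integrable_smul₀' (aemeasurable_gibbs_density h)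
    (Eventually.of_forall fun _ => ENNReal.ofReal_lt_top)]
  simp only [toReal_gibbs_density]
  have h0 : (∫ z, Real.exp (-Φ z))⁻¹ ≠ 0 := inv_ne_zero (integral_exp_pos h).ne'
  rw [← integrable_const_mul_iff (isUnit_iff_ne_zero.2 h0) fun x => F x * Real.exp (-Φ x)]
  refine integrable_congr (Eventually.of_forall fun x => ?_)
  simp only [smul_eq_mul]
  ring

theorem integral_gibbs (h : Integrable fun x => Real.exp (-Φ x))
    (F : EuclideanSpace ℝ (Fin n) → ℝ) :
    ∫ x, F x ∂gibbs Φ = (∫ x, F x * Real.exp (-Φ x)) / ∫ x, Real.exp (-Φ x) := by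
  rw [gibbs, integral_withDensity_eq_integral_toReal_smul₀ (aemeasurable_gibbs_density h)
    (Eventually.of_forall fun _ => ENNReal.ofReal_lt_top), ← integral_div]
  simp only [toReal_gibbs_density, smul_eq_mul]
  refine integral_congr_ae (Eventually.of_forall fun x => ?_)
  simp only
  ring

/-- The ratio of densities is e^{Φ-Ψ} Z_Φ / Z_Ψ: the first factor is at most e^{-a}, the ratio of
normalisations at most e^b. -/
theorem gibbs_le_smul_gibbs (hΦ : Integrable fun x => Real.exp (-Φ x))
    (hΨ : Integrable fun x => Real.exp (-Ψ x)) {a b : ℝ} (ha : ∀ x, a ≤ Ψ x - Φ x)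
    (hb : ∀ x, Ψ x - Φ x ≤ b) :
    gibbs Ψ ≤ ENNReal.ofReal (Real.exp (b - a)) • gibbs Φ := by
  rw [gibbs, gibbs, ← withDensity_smul' _ _ ENNReal.ofReal_ne_top]
  refine withDensity_mono (Eventually.of_forall fun x => ?_)
  simp only [Pi.smul_apply, smul_eq_mul]
  rw [← ENNReal.ofReal_mul (Real.exp_pos _).le]
  refine ENNReal.ofReal_le_ofReal ?_
  have hZ : Real.exp (-b) * ∫ x, Real.exp (-Φ x) ≤ ∫ x, Real.exp (-Ψ x) := by
    rw [← integral_const_mul]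
    refine integral_mono (hΦ.const_mul _) hΨ fun x => ?_
    simp only
    rw [← Real.exp_add]
    exact Real.exp_le_exp.2 (by linarith [hb x])
  have hZ0 := integral_exp_pos hΦ
  have hZ1 := integral_exp_pos hΨ
  rw [← mul_div_assoc, div_le_div_iff₀ hZ1 hZ0]
  have h1 : Real.exp (-Ψ x) ≤ Real.exp (-a) * Real.exp (-Φ x) := by
    rw [← Real.exp_add]
    exact Real.exp_le_exp.2 (by linarith [ha x])
  have e : Real.exp (b - a) * Real.exp (-b) = Real.exp (-a) := by
    rw [← Real.exp_add]; congr 1; ring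
  calc Real.exp (-Ψ x) * ∫ x, Real.exp (-Φ x)
      ≤ Real.exp (-a) * Real.exp (-Φ x) * ∫ x, Real.exp (-Φ x) := by gcongr
    _ = Real.exp (b - a) * Real.exp (-Φ x) * (Real.exp (-b) * ∫ x, Real.exp (-Φ x)) := by
      rw [← e]; ring
    _ ≤ _ := by gcongr

end gibbs

/-! ### Entropy bounds: perturbation and limits -/

section entropy

variable {α : Type*} [MeasurableSpace α] {μ ν : Measure α} {f : α → ℝ}

/-- The integrand of the entropy of `f` is integrable and the entropy is at most `I`. -/
structure EntropyLE (μ : Measure α) (f : α → ℝ) (I : ℝ) : Prop where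
  integrable : Integrable (entropyIntegrand μ f) μ
  entropy_le : entropy μ f ≤ I

/-- The nonnegative function `x log (x / a) - x + a`. -/
noncomputable def relEntropyFun (a x : ℝ) : ℝ := x * Real.log (x / a) - x + a

/-- This is log u ≤ u - 1 at u = a/x. Unlike the entropy integrand, this function has a sign, so
measures can be compared and Fatou's lemma applies. -/
theorem relEntropyFun_nonneg {a x : ℝ} (ha : 0 < a) (hx : 0 < x) : 0 ≤ relEntropyFun a x := by
  have h1 := Real.log_le_sub_one_of_pos (div_pos ha hx)
  have h2 : Real.log (x / a) = -Real.log (a / x) := by rw [← Real.log_inv, inv_div]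
  have h3 := mul_le_mul_of_nonneg_left h1 hx.le
  have h4 : x * (a / x - 1) = a - x := by field_simp
  rw [relEntropyFun, h2]
  linarith

theorem relEntropyFun_integral [IsProbabilityMeasure μ] (hf : Integrable f μ)
    (hi : Integrable (entropyIntegrand μ f) μ) :
    Integrable (fun x => relEntropyFun (∫ z, f z ∂μ) (f x)) μ ∧
      ∫ x, relEntropyFun (∫ z, f z ∂μ) (f x) ∂μ = entropy μ f := by
  have h1 : (fun x => relEntropyFun (∫ z, f z ∂μ) (f x)) =
      fun x => entropyIntegrand μ f x - f x + ∫ z, f z ∂μ := rfl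
  have h2 := (hi.sub hf).add (integrable_const (∫ z, f z ∂μ))
  refine ⟨h2, ?_⟩
  rw [h1]
  have h3 := integral_add (hi.sub hf) (integrable_const (μ := μ) (∫ z, f z ∂μ))
  simp only [Pi.sub_apply] at h3
  rw [h3, integral_sub hi hf]
  simp [entropy]

theorem integral_pos_of_forall_pos [IsProbabilityMeasure μ] (hf : Integrable f μ)
    (hf0 : ∀ x, 0 < f x) : 0 < ∫ x, f x ∂μ := by
  rw [integral_pos_iff_support_of_nonneg (fun x => (hf0 x).le) hf]
  have : Function.support f = Set.univ := by
    ext x; simp [(hf0 x).ne']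
  simp [this]

/-- Variational formula: if M is the mean of f, then ∫ `relEntropyFun a f` exceeds the entropy by
`relEntropyFun a M` ≥ 0, so any centring a gives an upper bound. -/
theorem entropyLE_of_relEntropyFun [IsProbabilityMeasure μ] (hf : Integrable f μ)
    (hf0 : ∀ x, 0 < f x) {a I : ℝ} (ha : 0 < a)
    (hi : Integrable (fun x => relEntropyFun a (f x)) μ)
    (hI : ∫ x, relEntropyFun a (f x) ∂μ ≤ I) : EntropyLE μ f I := by
  have hM := integral_pos_of_forall_pos hf hf0
  set M := ∫ z, f z ∂μ with hMdef
  have h1 : entropyIntegrand μ f = fun x =>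
      (relEntropyFun a (f x) + f x - a) + Real.log (a / M) * f x := by
    funext x
    rw [entropyIntegrand, relEntropyFun, ← hMdef, Real.log_div (hf0 x).ne' hM.ne',
      Real.log_div (hf0 x).ne' ha.ne', Real.log_div ha.ne' hM.ne']
    ring
  have h2 : Integrable (fun x => relEntropyFun a (f x) + f x - a) μ :=
    (hi.add hf).sub (integrable_const a)
  have h3 : Integrable (fun x => Real.log (a / M) * f x) μ := hf.const_mul _
  refine ⟨h1 ▸ h2.add h3, ?_⟩
  have h4 : entropy μ f = ∫ x, relEntropyFun a (f x) ∂μ + M - a + Real.log (a / M) * M := by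
    rw [entropy, h1, integral_add h2 h3, integral_const_mul]
    have := integral_sub (hi.add hf) (integrable_const (μ := μ) a)
    simp only [Pi.add_apply] at this
    rw [this, integral_add hi hf]
    simp [hMdef]
  have h5 := relEntropyFun_nonneg ha hM
  have h6 : Real.log (M / a) = -Real.log (a / M) := by rw [← Real.log_inv, inv_div]
  rw [relEntropyFun, h6] at h5
  rw [h4]
  linarith

/-- The Holley–Stroock perturbation argument. -/
theorem EntropyLE.of_le_smul [IsProbabilityMeasure μ] [IsProbabilityMeasure ν] {I c : ℝ}
    (h : EntropyLE μ f I) (hf : Integrable f μ) (hf0 : ∀ x, 0 < f x) (hc : 0 ≤ c)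
    (hν : ν ≤ ENNReal.ofReal c • μ) : EntropyLE ν f (c * I) := by
  obtain ⟨h1, h2⟩ := relEntropyFun_integral hf h.integrable
  have hM := integral_pos_of_forall_pos hf hf0
  -- The centring stays at the μ-mean of f; recentring at the ν-mean can only lower the integral.
  have h3 : ∫ x, relEntropyFun (∫ z, f z ∂μ) (f x) ∂ν ≤ c * I := by
    refine (integral_mono_measure hν (Eventually.of_forall fun x =>
      relEntropyFun_nonneg hM (hf0 x)) (h1.smul_measure ENNReal.ofReal_ne_top)).trans ?_
    rw [integral_smul_measure, ENNReal.toReal_ofReal hc, h2, smul_eq_mul]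
    exact mul_le_mul_of_nonneg_left h.entropy_le hc
  exact entropyLE_of_relEntropyFun ((hf.smul_measure ENNReal.ofReal_ne_top).mono_measure hν) hf0 hM
    ((h1.smul_measure ENNReal.ofReal_ne_top).mono_measure hν) h3

theorem EntropyLE.const_mul {I c : ℝ} (h : EntropyLE μ f I) (hc : 0 < c) :
    EntropyLE μ (fun x => c * f x) (c * I) := by
  have h1 : entropyIntegrand μ (fun x => c * f x) = fun x => c * entropyIntegrand μ f x := by
    funext x
    rw [entropyIntegrand, entropyIntegrand, integral_const_mul, mul_div_mul_left _ _ hc.ne',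
      mul_assoc]
  refine ⟨h1 ▸ h.integrable.const_mul c, ?_⟩
  rw [entropy, h1, integral_const_mul]
  exact mul_le_mul_of_nonneg_left h.entropy_le hc.le

/-- Domination by G makes the means converge, hence the centred integrands converge pointwise.
Fatou's lemma then yields integrability of the limit together with the bound. -/
theorem EntropyLE.of_tendsto [IsProbabilityMeasure μ] {F : ℕ → α → ℝ} {G : α → ℝ} {I : ℕ → ℝ}
    {J : ℝ} (h : ∀ k, EntropyLE μ (F k) (I k)) (hF : ∀ k, Measurable (F k))
    (hF0 : ∀ k x, 0 < F k x) (hf0 : ∀ x, 0 < f x) (hG : Integrable G μ)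
    (hFG : ∀ k x, F k x ≤ G x) (hlim : ∀ x, Tendsto (fun k => F k x) atTop (nhds (f x)))
    (hI : Tendsto I atTop (nhds J)) : EntropyLE μ f J := by
  have hFi : ∀ k, Integrable (F k) μ := fun k =>
    hG.mono' (hF k).aestronglyMeasurable (Eventually.of_forall fun x => by
      rw [Real.norm_of_nonneg (hF0 k x).le]; exact hFG k x)
  have hfm : Measurable f := measurable_of_tendsto_metrizable hF (tendsto_pi_nhds.2 hlim)
  have hfi : Integrable f μ := hG.mono' hfm.aestronglyMeasurable
    (Eventually.of_forall fun x => by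
      rw [Real.norm_of_nonneg (hf0 x).le]
      exact le_of_tendsto (hlim x) (Eventually.of_forall fun k => hFG k x))
  have hM := integral_pos_of_forall_pos hfi hf0
  have hMk := fun k => integral_pos_of_forall_pos (hFi k) (hF0 k)
  have hMlim : Tendsto (fun k => ∫ x, F k x ∂μ) atTop (nhds (∫ x, f x ∂μ)) :=
    tendsto_integral_of_dominated_convergence G (fun k => (hF k).aestronglyMeasurable) hG
      (fun k => Eventually.of_forall fun x => by
        rw [Real.norm_of_nonneg (hF0 k x).le]; exact hFG k x)
      (Eventually.of_forall hlim)
  have hmeas : ∀ {u : α → ℝ} (a : ℝ), Measurable u → Measurable fun x => relEntropyFun a (u x) := by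
    intro u a hu
    unfold relEntropyFun
    fun_prop
  have hKlim : ∀ x, Tendsto (fun k => relEntropyFun (∫ z, F k z ∂μ) (F k x)) atTop
      (nhds (relEntropyFun (∫ z, f z ∂μ) (f x))) := fun x =>
    (((hlim x).mul (((hlim x).div hMlim hM.ne').log (div_pos (hf0 x) hM).ne')).sub
      (hlim x)).add hMlim
  have hnn : ∀ k x, 0 ≤ relEntropyFun (∫ z, F k z ∂μ) (F k x) := fun k x =>
    relEntropyFun_nonneg (hMk k) (hF0 k x)
  have hnn' : ∀ x, 0 ≤ relEntropyFun (∫ z, f z ∂μ) (f x) := fun x =>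
    relEntropyFun_nonneg hM (hf0 x)
  have hbound : ∫⁻ x, ENNReal.ofReal (relEntropyFun (∫ z, f z ∂μ) (f x)) ∂μ ≤ ENNReal.ofReal J := by
    have h1 : ∀ x, ENNReal.ofReal (relEntropyFun (∫ z, f z ∂μ) (f x)) =
        liminf (fun k => ENNReal.ofReal (relEntropyFun (∫ z, F k z ∂μ) (F k x))) atTop := fun x =>
      ((ENNReal.continuous_ofReal.tendsto _).comp (hKlim x)).liminf_eq.symm
    simp_rw [h1]
    refine (lintegral_liminf_le fun k => (hmeas _ (hF k)).ennreal_ofReal).trans ?_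
    rw [← ((ENNReal.continuous_ofReal.tendsto _).comp hI).liminf_eq]
    refine liminf_le_liminf (Eventually.of_forall fun k => ?_)
    obtain ⟨e1, e2⟩ := relEntropyFun_integral (hFi k) (h k).integrable
    rw [← ofReal_integral_eq_lintegral_ofReal e1 (Eventually.of_forall (hnn k)), e2]
    exact ENNReal.ofReal_le_ofReal (h k).entropy_le
  have hJ0 : 0 ≤ J := by
    refine ge_of_tendsto' hI fun k => ?_
    refine le_trans ?_ (h k).entropy_le
    rw [← (relEntropyFun_integral (hFi k) (h k).integrable).2]
    exact integral_nonneg (hnn k)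
  have hKi : Integrable (fun x => relEntropyFun (∫ z, f z ∂μ) (f x)) μ :=
    (lintegral_ofReal_ne_top_iff_integrable (hmeas _ hfm).aestronglyMeasurable
      (Eventually.of_forall hnn')).1 (hbound.trans_lt ENNReal.ofReal_lt_top).ne
  refine entropyLE_of_relEntropyFun hfi hf0 hM hKi ?_
  rw [← ofReal_integral_eq_lintegral_ofReal hKi (Eventually.of_forall hnn'),
    ENNReal.ofReal_le_ofReal_iff hJ0] at hbound
  exact hbound

end entropy

theorem SuperlinearConvex.entropyLE_of_hasCompactSupport {n : ℕ}
    {φ : EuclideanSpace ℝ (Fin n) → ℝ} (h : SuperlinearConvex φ)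
    {g : EuclideanSpace ℝ (Fin n) → ℝ} (hg : ContDiff ℝ 1 g) (hs : HasCompactSupport g)
    (hg0 : ∀ x, g x ≤ 0) :
    EntropyLE (gibbs φ) (fun x => Real.exp (g x))
      (∫ x, energyDensity φ g x * Real.exp (g x) ∂gibbs φ) := by
  have hφc := h.continuous
  have hgc := hg.continuous
  have hEc := h.continuous_energyDensity hg
  have hiφ := h.integrable_exp_neg
  have hmul : ∀ x, Real.exp (g x) * Real.exp (-φ x) = Real.exp (g x - φ x) := fun x => by
    rw [← Real.exp_add, sub_eq_add_neg]
  have hig : Integrable fun x => Real.exp (g x - φ x) := by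
    refine hiφ.mono' (by fun_prop) (Eventually.of_forall fun x => ?_)
    rw [Real.norm_eq_abs, Real.abs_exp]
    exact Real.exp_le_exp.2 (by linarith [hg0 x])
  obtain ⟨B, hB⟩ := hgc.bounded_above_of_compact_support hs
  obtain ⟨W, hW⟩ := h.exists_abs_energyDensity_sub_le hg hs
  have hi1 : Integrable fun x => g x * Real.exp (g x - φ x) :=
    hig.bdd_mul (by fun_prop) (Eventually.of_forall hB)
  have hi2 : Integrable fun x => (energyDensity φ g x - g x) * Real.exp (g x - φ x) :=
    hig.bdd_mul (by fun_prop) (Eventually.of_forall hW)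
  have hM0 := integral_exp_pos hig
  have hZ0 := integral_exp_pos hiφ
  have hmain := h.mul_log_le_integral_of_hasCompactSupport hg hs hg0
  have hmean : ∫ z, Real.exp (g z) ∂gibbs φ =
      (∫ x, Real.exp (g x - φ x)) / ∫ x, Real.exp (-φ x) := by
    rw [integral_gibbs hiφ]
    simp_rw [hmul]
  set M := ∫ x, Real.exp (g x - φ x)
  set Z := ∫ x, Real.exp (-φ x)
  have hent : ∀ x, entropyIntegrand (gibbs φ) (fun x => Real.exp (g x)) x * Real.exp (-φ x) =
      g x * Real.exp (g x - φ x) + Real.log (Z / M) * Real.exp (g x - φ x) := by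
    intro x
    rw [entropyIntegrand, hmean, Real.log_div (Real.exp_pos _).ne' (div_pos hM0 hZ0).ne',
      Real.log_exp, Real.log_div hM0.ne' hZ0.ne', Real.log_div hZ0.ne' hM0.ne', ← hmul]
    ring
  refine ⟨?_, ?_⟩
  · rw [integrable_gibbs_iff hiφ]
    simp_rw [hent]
    exact hi1.add (hig.const_mul _)
  · rw [entropy, integral_gibbs hiφ, integral_gibbs hiφ]
    simp_rw [hent]
    refine div_le_div_of_nonneg_right ?_ hZ0.le
    rw [integral_add hi1 (hig.const_mul _), integral_const_mul]
    have h1 : ∀ x, energyDensity φ g x * Real.exp (g x) * Real.exp (-φ x) =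
        g x * Real.exp (g x - φ x) + (energyDensity φ g x - g x) * Real.exp (g x - φ x) := by
      intro x
      rw [mul_assoc, hmul]
      ring
    simp_rw [h1]
    rw [integral_add hi1 hi2]
    linarith

theorem HasDerivAt.comp_hasGradientAt {V : Type*} [NormedAddCommGroup V] [InnerProductSpace ℝ V]
    [CompleteSpace V] {f : ℝ → ℝ} {g : V → ℝ} {f' : ℝ} {p x : V} (hf : HasDerivAt f f' (g x))
    (hg : HasGradientAt g p x) : HasGradientAt (fun y => f (g y)) (f' • p) x := by
  rw [hasGradientAt_iff_hasFDerivAt] at hg ⊢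
  rw [map_smul]
  exact hf.comp_hasFDerivAt x hg

/-! ### Smooth truncations -/

/-- A `C¹` variant of `min (g - m) 0`. -/
noncomputable def truncateAbove {V : Type*} (m : ℝ) (g : V → ℝ) (x : V) : ℝ :=
  -smoothPosPart (m - g x)

/-- A function of `φ` that is constant, about `-k`, where `φ ≤ k`, and zero where `φ` is large. -/
noncomputable def sublevelBarrier {V : Type*} (φ : V → ℝ) (k : ℝ) (x : V) : ℝ :=
  -smoothPosPart (k - smoothPosPart (φ x - k))

/-- A `C¹` variant of the maximum of `u` and `v`. -/
noncomputable def smoothMax {V : Type*} (u v : V → ℝ) (x : V) : ℝ :=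
  u x + smoothPosPart (v x - u x)

section pointwise

variable {V : Type*} {g φ u v : V → ℝ} {m k : ℝ} {x : V}

theorem truncateAbove_nonpos : truncateAbove m g x ≤ 0 :=
  neg_nonpos.2 (smoothPosPart_nonneg _)

theorem truncateAbove_le : truncateAbove m g x ≤ g x - m + 1 / 2 := by
  have := sub_half_le_smoothPosPart (m - g x)
  unfold truncateAbove
  linarith

theorem truncateAbove_of_le (h : g x + 1 ≤ m) : truncateAbove m g x = g x - m + 1 / 2 := by
  rw [truncateAbove, smoothPosPart_of_one_le (by linarith)]
  ring

theorem sublevelBarrier_nonpos : sublevelBarrier φ k x ≤ 0 :=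
  neg_nonpos.2 (smoothPosPart_nonneg _)

theorem sublevelBarrier_of_le (h : φ x ≤ k) : sublevelBarrier φ k x = -smoothPosPart k := by
  rw [sublevelBarrier, smoothPosPart_of_nonpos (u := φ x - k) (by linarith), sub_zero]

theorem sublevelBarrier_of_ge (h : 2 * k + 1 ≤ φ x) : sublevelBarrier φ k x = 0 := by
  have := sub_half_le_smoothPosPart (φ x - k)
  rw [sublevelBarrier, smoothPosPart_of_nonpos (by linarith), neg_zero]

theorem smoothMax_le_max : smoothMax u v x ≤ max (u x) (v x) := by
  have h := smoothPosPart_le_max (v x - u x)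
  have h2 : u x + max (v x - u x) 0 = max (v x) (u x) := by
    rw [← max_add_add_left]; simp
  rw [max_comm, ← h2]
  unfold smoothMax
  linarith

theorem smoothMax_of_le (h : u x + 1 ≤ v x) : smoothMax u v x = v x - 1 / 2 := by
  rw [smoothMax, smoothPosPart_of_one_le (by linarith)]
  ring

end pointwise

section differentiability

variable {V : Type*} [NormedAddCommGroup V] [InnerProductSpace ℝ V] {g φ u v : V → ℝ} {m k : ℝ}

theorem ContDiff.truncateAbove (hg : ContDiff ℝ 1 g) : ContDiff ℝ 1 (truncateAbove m g) :=
  (contDiff_smoothPosPart.comp (contDiff_const.sub hg)).neg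

theorem ContDiff.sublevelBarrier (hφ : ContDiff ℝ 1 φ) : ContDiff ℝ 1 (sublevelBarrier φ k) :=
  (contDiff_smoothPosPart.comp
    (contDiff_const.sub (contDiff_smoothPosPart.comp (hφ.sub contDiff_const)))).neg

theorem ContDiff.smoothMax (hu : ContDiff ℝ 1 u) (hv : ContDiff ℝ 1 v) :
    ContDiff ℝ 1 (smoothMax u v) :=
  hu.add (contDiff_smoothPosPart.comp (hv.sub hu))

variable [CompleteSpace V]

theorem gradient_truncateAbove (hg : ContDiff ℝ 1 g) (x : V) :
    gradient (truncateAbove m g) x = smoothPosPartDeriv (m - g x) • gradient g x := by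
  have h1 : HasDerivAt (fun r => -smoothPosPart (m - r)) (smoothPosPartDeriv (m - g x)) (g x) := by
    have := ((hasDerivAt_smoothPosPart (m - g x)).comp_const_sub m (g x)).neg
    rwa [neg_neg] at this
  exact (h1.comp_hasGradientAt (hg.differentiable one_ne_zero x).hasGradientAt).gradient

theorem gradient_sublevelBarrier (hφ : ContDiff ℝ 1 φ) (x : V) :
    gradient (sublevelBarrier φ k) x =
      (smoothPosPartDeriv (k - smoothPosPart (φ x - k)) * smoothPosPartDeriv (φ x - k)) •
        gradient φ x := by
  have h1 : HasDerivAt (fun r => -smoothPosPart (k - smoothPosPart (r - k)))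
      (smoothPosPartDeriv (k - smoothPosPart (φ x - k)) * smoothPosPartDeriv (φ x - k)) (φ x) := by
    have h2 := (hasDerivAt_smoothPosPart (φ x - k)).comp_sub_const (φ x) k
    have h3 := ((hasDerivAt_smoothPosPart (k - smoothPosPart (φ x - k))).comp (φ x)
      (h2.const_sub k)).neg
    exact h3.congr_deriv (by ring)
  exact (h1.comp_hasGradientAt (hφ.differentiable one_ne_zero x).hasGradientAt).gradient

theorem gradient_smoothMax (hu : ContDiff ℝ 1 u) (hv : ContDiff ℝ 1 v) (x : V) :
    gradient (smoothMax u v) x =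
      (1 - smoothPosPartDeriv (v x - u x)) • gradient u x +
        smoothPosPartDeriv (v x - u x) • gradient v x := by
  have h1 := (hasGradientAt_iff_hasFDerivAt.1 (hu.differentiable one_ne_zero x).hasGradientAt)
  have h2 := (hasGradientAt_iff_hasFDerivAt.1 (hv.differentiable one_ne_zero x).hasGradientAt)
  have h3 := h1.add ((hasDerivAt_smoothPosPart (v x - u x)).comp_hasFDerivAt x (h2.sub h1))
  refine HasGradientAt.gradient (hasGradientAt_iff_hasFDerivAt.2 (h3.congr_fderiv ?_))
  rw [← map_sub, ← map_smul, ← map_add]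
  congr 1
  module

end differentiability

/-! ### Energy of the truncations and passage to general g -/

namespace SuperlinearConvex

variable {n : ℕ} {φ g : EuclideanSpace ℝ (Fin n) → ℝ}

/-- Outside a ball φ ≥ 2k + 1, so the barrier is 0 there, and v ≤ 0 adds nothing to it. -/
theorem hasCompactSupport_smoothMax_sublevelBarrier (h : SuperlinearConvex φ)
    {v : EuclideanSpace ℝ (Fin n) → ℝ} (hv : ∀ x, v x ≤ 0) (k : ℝ) :
    HasCompactSupport (smoothMax (sublevelBarrier φ k) v) := by
  obtain ⟨C, hC⟩ := exists_mul_norm_sub_le h.continuous h.tendsto 1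
  refine HasCompactSupport.intro (K := Metric.closedBall 0 (2 * k + 1 + C))
    (isCompact_closedBall _ _) fun x hx => ?_
  rw [mem_closedBall_zero_iff, not_le] at hx
  have h1 : sublevelBarrier φ k x = 0 := sublevelBarrier_of_ge (by linarith [hC x])
  rw [smoothMax, h1, sub_zero, smoothPosPart_of_nonpos (hv x), add_zero]

theorem energyDensity_truncateAbove_le (h : SuperlinearConvex φ) (hg : ContDiff ℝ 1 g) (m : ℝ)
    (x : EuclideanSpace ℝ (Fin n)) :
    energyDensity φ (truncateAbove m g) x ≤ energyDensity φ g x := by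
  rw [energyDensity_eq_legendreCost, energyDensity_eq_legendreCost, gradient_truncateAbove hg]
  refine (h.legendreCost_smul_le _ _ (smoothPosPartDeriv_nonneg _)
    (smoothPosPartDeriv_le_one _)).trans ?_
  exact mul_le_of_le_one_left (h.legendreCost_nonneg _ _) (smoothPosPartDeriv_le_one _)

/-- The gradient of the barrier is a multiple in [0, 1] of ∇φ, whose cost is φ + φ*(0), and it
vanishes where φ < k. -/
theorem energyDensity_sublevelBarrier_le (h : SuperlinearConvex φ) (k : ℝ)
    (x : EuclideanSpace ℝ (Fin n)) :
    energyDensity φ (sublevelBarrier φ k) x ≤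
      Set.indicator {y | k ≤ φ y} (fun y => φ y + legendre φ 0) x := by
  rw [energyDensity_eq_legendreCost, gradient_sublevelBarrier h.contDiff]
  by_cases hx : k ≤ φ x
  · rw [Set.indicator_of_mem (by exact hx)]
    have h1 := smoothPosPartDeriv_nonneg (k - smoothPosPart (φ x - k))
    have h2 := smoothPosPartDeriv_le_one (k - smoothPosPart (φ x - k))
    have h3 := smoothPosPartDeriv_nonneg (φ x - k)
    have h4 := smoothPosPartDeriv_le_one (φ x - k)
    have h5 := mul_le_one₀ h2 h3 h4
    refine (h.legendreCost_smul_le _ _ (mul_nonneg h1 h3) h5).trans ?_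
    rw [h.legendreCost_gradient]
    exact mul_le_of_le_one_left (h.neg_legendre_zero_le _) h5
  · rw [Set.indicator_of_notMem (by exact hx), smoothPosPartDeriv_of_nonpos (u := φ x - k) (by linarith),
      mul_zero, zero_smul, legendreCost_zero]

/-- The gradient is a convex combination. The weight on v is kept because it vanishes where v ≤ u,
which is needed to dominate the energy by that of v. -/
theorem energyDensity_smoothMax_le (h : SuperlinearConvex φ)
    {u v : EuclideanSpace ℝ (Fin n) → ℝ} (hu : ContDiff ℝ 1 u) (hv : ContDiff ℝ 1 v)
    (x : EuclideanSpace ℝ (Fin n)) :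
    energyDensity φ (smoothMax u v) x ≤
      energyDensity φ u x + smoothPosPartDeriv (v x - u x) * energyDensity φ v x := by
  have h0 := smoothPosPartDeriv_nonneg (v x - u x)
  have h1 := smoothPosPartDeriv_le_one (v x - u x)
  have h2 := (h.convexOn_legendreCost x).2 (Set.mem_univ (gradient u x))
    (Set.mem_univ (gradient v x)) (sub_nonneg.2 h1) h0 (by ring)
  rw [← gradient_smoothMax hu hv x] at h2
  refine h2.trans (add_le_add ?_ le_rfl)
  exact mul_le_of_le_one_left (h.legendreCost_nonneg _ _) (by linarith)

/-- The inequality for nonpositive functions, by cutting off at infinity. -/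
theorem entropyLE_of_nonpos (h : SuperlinearConvex φ) (hg : ContDiff ℝ 1 g)
    (hg0 : ∀ x, g x ≤ 0)
    (hE : Integrable (fun x => energyDensity φ g x * Real.exp (g x)) (gibbs φ)) :
    EntropyLE (gibbs φ) (fun x => Real.exp (g x - 1 / 2))
      (∫ x, energyDensity φ g x * Real.exp (g x - 1 / 2) ∂gibbs φ) := by
  have hiφ := h.integrable_exp_neg
  have := isProbabilityMeasure_gibbs hiφ
  have hφc := h.continuous
  have hgc := hg.continuous
  have hEc := h.continuous_energyDensity hg
  set w : ℕ → EuclideanSpace ℝ (Fin n) → ℝ := fun k => sublevelBarrier φ (k : ℝ) with hw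
  have hwd : ∀ k, ContDiff ℝ 1 (w k) := fun k => h.contDiff.sublevelBarrier
  have hwc := fun k => (hwd k).continuous
  have hmd : ∀ k, ContDiff ℝ 1 (smoothMax (w k) g) := fun k => (hwd k).smoothMax hg
  have hmc := fun k => (hmd k).continuous
  have hm0 : ∀ k x, smoothMax (w k) g x ≤ 0 := fun k x =>
    smoothMax_le_max.trans (max_le sublevelBarrier_nonpos (hg0 x))
  have hdc : Continuous smoothPosPartDeriv := by unfold smoothPosPartDeriv; fun_prop
  set A : ℕ → EuclideanSpace ℝ (Fin n) → ℝ := fun k =>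
    Set.indicator {y | (k : ℝ) ≤ φ y} fun y => φ y + legendre φ 0 with hA
  set B : ℕ → EuclideanSpace ℝ (Fin n) → ℝ := fun k x =>
    smoothPosPartDeriv (g x - w k x) * energyDensity φ g x * Real.exp (smoothMax (w k) g x) with hB
  have hφi : Integrable (fun x => φ x + legendre φ 0) (gibbs φ) :=
    (integrable_gibbs_iff hiφ).2 h.integrable_add_const_mul_exp_neg
  have hAm : ∀ k, MeasurableSet {y | (k : ℕ) ≤ φ y} := fun k =>
    measurableSet_le measurable_const hφc.measurable
  have hAi : ∀ k, Integrable (A k) (gibbs φ) := fun k => hφi.indicator (hAm k)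
  have hBm : ∀ k, AEStronglyMeasurable (B k) (gibbs φ) := fun k => by
    have h1 := hwc k
    have h2 := hmc k
    have : Continuous (B k) := by fun_prop
    exact this.aestronglyMeasurable
  have hB0 : ∀ k x, 0 ≤ B k x := fun k x =>
    mul_nonneg (mul_nonneg (smoothPosPartDeriv_nonneg _) (h.legendreCost_nonneg _ _))
      (Real.exp_pos _).le
  have hBle : ∀ k x, B k x ≤ energyDensity φ g x * Real.exp (g x) := by
    intro k x
    have hE0 : 0 ≤ energyDensity φ g x := h.legendreCost_nonneg _ _
    -- Where g ≤ w the weight is zero; elsewhere the smooth maximum is at most g.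
    rcases le_or_gt (g x) (w k x) with hx | hx
    · simp only [hB, smoothPosPartDeriv_of_nonpos (sub_nonpos.2 hx), zero_mul]
      positivity
    · have h1 : smoothMax (w k) g x ≤ g x := smoothMax_le_max.trans (max_le hx.le le_rfl)
      have h2 := smoothPosPartDeriv_le_one (g x - w k x)
      have h3 := mul_le_of_le_one_left hE0 h2
      exact mul_le_mul h3 (Real.exp_le_exp.2 h1) (Real.exp_pos _).le hE0
  have hBn : ∀ k x, ‖B k x‖ ≤ energyDensity φ g x * Real.exp (g x) := fun k x => by
    rw [Real.norm_of_nonneg (hB0 k x)]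
    exact hBle k x
  have hBi : ∀ k, Integrable (B k) (gibbs φ) := fun k =>
    hE.mono' (hBm k) (Eventually.of_forall (hBn k))
  have hAB : ∀ k x, energyDensity φ (smoothMax (w k) g) x * Real.exp (smoothMax (w k) g x) ≤
      A k x + B k x := by
    intro k x
    have h1 := h.energyDensity_smoothMax_le (hwd k) hg x
    have h2 := h.energyDensity_sublevelBarrier_le k x
    have hA0 : 0 ≤ A k x := Set.indicator_nonneg (fun y _ => h.neg_legendre_zero_le y) x
    have h3 : Real.exp (smoothMax (w k) g x) ≤ 1 := Real.exp_le_one_iff.2 (hm0 k x)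
    calc energyDensity φ (smoothMax (w k) g) x * Real.exp (smoothMax (w k) g x)
        ≤ (A k x + smoothPosPartDeriv (g x - w k x) * energyDensity φ g x) *
            Real.exp (smoothMax (w k) g x) := by
          gcongr
          exact h1.trans (add_le_add h2 le_rfl)
      _ = A k x * Real.exp (smoothMax (w k) g x) + B k x := add_mul _ _ _
      _ ≤ _ := by
          gcongr
          exact mul_le_of_le_one_right hA0 h3
  -- At each point the barrier eventually drops below g - 1, and the smooth maximum is then g - 1/2;
  -- this is the source of the shift in the conclusion.
  have hev : ∀ x, ∀ᶠ k : ℕ in atTop, w k x + 1 ≤ g x := by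
    intro x
    filter_upwards [tendsto_natCast_atTop_atTop.eventually_ge_atTop (max (φ x) (3 / 2 - g x))]
      with k hk
    have h1 : φ x ≤ k := (le_max_left _ _).trans hk
    have h2 : 3 / 2 - g x ≤ k := (le_max_right _ _).trans hk
    have h3 := sub_half_le_smoothPosPart (k : ℝ)
    simp only [hw]
    rw [sublevelBarrier_of_le h1]
    linarith
  have hAlim : Tendsto (fun k => ∫ x, A k x ∂gibbs φ) atTop (nhds 0) := by
    have := tendsto_integral_of_dominated_convergence (F := A) (f := fun _ => 0)
      (fun x => φ x + legendre φ 0) (fun k => (hAi k).aestronglyMeasurable) hφi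
      (fun k => Eventually.of_forall fun x => by
        rw [Real.norm_of_nonneg (Set.indicator_nonneg (fun y _ => h.neg_legendre_zero_le y) x)]
        exact Set.indicator_le_self' (fun y _ => h.neg_legendre_zero_le y) x)
      (Eventually.of_forall fun x => by
        refine tendsto_const_nhds.congr' ?_
        filter_upwards [tendsto_natCast_atTop_atTop.eventually_gt_atTop (φ x)] with k hk
        simp only [hA]
        rw [Set.indicator_of_notMem]
        exact not_le.2 hk)
    simpa using this
  have hBlim : Tendsto (fun k => ∫ x, B k x ∂gibbs φ) atTop
      (nhds (∫ x, energyDensity φ g x * Real.exp (g x - 1 / 2) ∂gibbs φ)) := by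
    refine tendsto_integral_of_dominated_convergence _ hBm hE
      (fun k => Eventually.of_forall (hBn k)) (Eventually.of_forall fun x => ?_)
    refine tendsto_const_nhds.congr' ?_
    filter_upwards [hev x] with k hk
    simp only [hB]
    rw [smoothMax_of_le hk, smoothPosPartDeriv_of_one_le (by linarith), one_mul]
  refine EntropyLE.of_tendsto (F := fun k x => Real.exp (smoothMax (w k) g x)) (G := fun _ => 1)
    (I := fun k => ∫ x, A k x ∂gibbs φ + ∫ x, B k x ∂gibbs φ) (fun k => ?_)
    (fun k => (Real.continuous_exp.comp (hmc k)).measurable) (fun k x => Real.exp_pos _)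
    (fun x => Real.exp_pos _) (integrable_const 1)
    (fun k x => Real.exp_le_one_iff.2 (hm0 k x)) (fun x => ?_) ?_
  · have h1 := h.entropyLE_of_hasCompactSupport (hmd k)
      (h.hasCompactSupport_smoothMax_sublevelBarrier hg0 k) (hm0 k)
    refine ⟨h1.integrable, h1.entropy_le.trans ?_⟩
    rw [← integral_add (hAi k) (hBi k)]
    exact integral_mono_of_nonneg (Eventually.of_forall fun x =>
      mul_nonneg (h.legendreCost_nonneg _ _) (Real.exp_pos _).le) ((hAi k).add (hBi k))
      (Eventually.of_forall (hAB k))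
  · refine tendsto_const_nhds.congr' ?_
    filter_upwards [hev x] with k hk
    rw [smoothMax_of_le hk]
  · simpa using hAlim.add hBlim

/-- The modified logarithmic Sobolev inequality for the measure of density `exp (-φ)`. -/
theorem entropyLE_gibbs (h : SuperlinearConvex φ) (hg : ContDiff ℝ 1 g)
    (hi : Integrable (fun x => Real.exp (g x)) (gibbs φ))
    (hE : Integrable (fun x => energyDensity φ g x * Real.exp (g x)) (gibbs φ)) :
    EntropyLE (gibbs φ) (fun x => Real.exp (g x))
      (∫ x, energyDensity φ g x * Real.exp (g x) ∂gibbs φ) := by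
  have hiφ := h.integrable_exp_neg
  have := isProbabilityMeasure_gibbs hiφ
  set T : ℕ → EuclideanSpace ℝ (Fin n) → ℝ := fun m => truncateAbove (m : ℝ) g with hT
  have hTd : ∀ m, ContDiff ℝ 1 (T m) := fun m => hg.truncateAbove
  have hTc := fun m => (hTd m).continuous
  have hEc := fun m => h.continuous_energyDensity (hTd m)
  -- The compensation m - 1/2 undoes the truncation: T m is g - m + 1/2 where g ≤ m - 1. Its -1/2 is
  -- the shift in `entropyLE_of_nonpos`; the factor e^m comes from homogeneity of the entropy.
  have hTle : ∀ (m : ℕ) x, (m : ℝ) + (T m x - 1 / 2) ≤ g x := fun m x => by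
    have : T m x ≤ g x - m + 1 / 2 := truncateAbove_le
    linarith
  have hE0 : ∀ m x, 0 ≤ energyDensity φ (T m) x := fun m x => h.legendreCost_nonneg _ _
  have hEle : ∀ m x, energyDensity φ (T m) x ≤ energyDensity φ g x := fun m x =>
    h.energyDensity_truncateAbove_le hg m x
  have hdom : ∀ m x, ‖energyDensity φ (T m) x * Real.exp (m + (T m x - 1 / 2))‖ ≤
      energyDensity φ g x * Real.exp (g x) := fun m x => by
    rw [Real.norm_of_nonneg (mul_nonneg (hE0 m x) (Real.exp_pos _).le)]
    exact mul_le_mul (hEle m x) (Real.exp_le_exp.2 (hTle m x)) (Real.exp_pos _).le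
      ((hE0 m x).trans (hEle m x))
  have hmeas : ∀ m : ℕ, Continuous fun x =>
      energyDensity φ (T m) x * Real.exp (m + (T m x - 1 / 2)) := fun m => by
    have h1 := hTc m
    have h2 := hEc m
    fun_prop
  have hTi : ∀ m, Integrable (fun x => energyDensity φ (T m) x * Real.exp (T m x)) (gibbs φ) := by
    intro m
    have h1 : Integrable (fun x => energyDensity φ (T m) x * Real.exp (m + (T m x - 1 / 2)))
        (gibbs φ) := hE.mono' (hmeas m).aestronglyMeasurable (Eventually.of_forall (hdom m))
    refine (h1.const_mul (Real.exp (1 / 2 - m))).congr (Eventually.of_forall fun x => ?_)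
    simp only
    rw [mul_left_comm, ← Real.exp_add]
    congr 2
    ring
  have hev : ∀ x, ∀ᶠ m : ℕ in atTop, g x + 1 ≤ m := fun x =>
    tendsto_natCast_atTop_atTop.eventually_ge_atTop (g x + 1)
  refine EntropyLE.of_tendsto (F := fun (m : ℕ) x => Real.exp (m + (T m x - 1 / 2)))
    (G := fun x => Real.exp (g x))
    (I := fun m => ∫ x, energyDensity φ (T m) x * Real.exp (m + (T m x - 1 / 2)) ∂gibbs φ)
    (fun m => ?_) (fun m => ?_) (fun m x => Real.exp_pos _)
    (fun x => Real.exp_pos _) hi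
    (fun m x => Real.exp_le_exp.2 (hTle m x)) (fun x => ?_) ?_
  · have h1 := (h.entropyLE_of_nonpos (hTd m) (fun x => truncateAbove_nonpos) (hTi m)).const_mul
      (Real.exp_pos m)
    rw [← integral_const_mul] at h1
    simp_rw [Real.exp_add, mul_left_comm (energyDensity φ (T m) _)]
    exact h1
  · have h1 := hTc m
    fun_prop
  · refine tendsto_const_nhds.congr' ?_
    filter_upwards [hev x] with m hm
    simp only [hT]
    rw [truncateAbove_of_le hm]
    congr 1
    ring
  · refine tendsto_integral_of_dominated_convergence _ (fun m => (hmeas m).aestronglyMeasurable) hE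
      (fun m => Eventually.of_forall (hdom m)) (Eventually.of_forall fun x => ?_)
    refine tendsto_const_nhds.congr' ?_
    filter_upwards [hev x] with m hm
    rw [energyDensity_eq_legendreCost, energyDensity_eq_legendreCost]
    simp only [hT]
    rw [truncateAbove_of_le hm, gradient_truncateAbove hg,
      smoothPosPartDeriv_of_one_le (by linarith), one_smul]
    congr 2
    ring

end SuperlinearConvex

/-! ### The bounded perturbation U -/

theorem mainTheorem2 (n : ℕ) (φ U : EuclideanSpace ℝ (Fin n) → ℝ)
    (hφ : ContDiff ℝ 1 φ) (hφconv : StrictConvexOn ℝ Set.univ φ)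
    (hφlim : Tendsto (fun x => φ x / ‖x‖) (cocompact (EuclideanSpace ℝ (Fin n))) atTop)
    (hU : AEMeasurable U volume) (hUbdd : ∃ C : ℝ, ∀ x, |U x| ≤ C) :
    Integrable (fun x => Real.exp (-(φ x + U x))) ∧
    IsProbabilityMeasure (GibbsEntropy.gibbs fun x => φ x + U x) ∧
    ∀ g : EuclideanSpace ℝ (Fin n) → ℝ, ContDiff ℝ 1 g →
      Integrable (fun x => Real.exp (g x)) (GibbsEntropy.gibbs fun x => φ x + U x) →
      Integrable (fun x => GibbsEntropy.energyDensity φ g x * Real.exp (g x))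
        (GibbsEntropy.gibbs fun x => φ x + U x) →
      Integrable (GibbsEntropy.entropyIntegrand (GibbsEntropy.gibbs fun x => φ x + U x)
        (fun x => Real.exp (g x))) (GibbsEntropy.gibbs fun x => φ x + U x) ∧
      GibbsEntropy.entropy (GibbsEntropy.gibbs fun x => φ x + U x) (fun x => Real.exp (g x)) ≤
        Real.exp (2 * GibbsEntropy.osc U) *
          ∫ x, GibbsEntropy.energyDensity φ g x * Real.exp (g x)
            ∂(GibbsEntropy.gibbs fun x => φ x + U x) := by
  have h : SuperlinearConvex φ := ⟨hφ, hφconv.convexOn, hφlim⟩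
  obtain ⟨C, hC⟩ := hUbdd
  have hiφ := h.integrable_exp_neg
  have hiΦ := h.integrable_exp_neg_add hU hC
  have hpφ := isProbabilityMeasure_gibbs hiφ
  have hpΦ := isProbabilityMeasure_gibbs (Φ := fun x => φ x + U x) hiΦ
  refine ⟨hiΦ, hpΦ, fun g hg hi hE => ?_⟩
  have hsup : ∀ x, U x ≤ ⨆ y, U y := le_ciSup ⟨C, by
    rintro _ ⟨x, rfl⟩
    exact (abs_le.1 (hC x)).2⟩
  have hinf : ∀ x, ⨅ y, U y ≤ U x := ciInf_le ⟨-C, by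
    rintro _ ⟨x, rfl⟩
    exact (abs_le.1 (hC x)).1⟩
  set c := Real.exp (GibbsEntropy.osc U) with hc
  have hΦφ : GibbsEntropy.gibbs (fun x => φ x + U x) ≤ ENNReal.ofReal c • GibbsEntropy.gibbs φ :=
    gibbs_le_smul_gibbs hiφ hiΦ (fun x => by simpa using hinf x) fun x => by simpa using hsup x
  have hφΦ : GibbsEntropy.gibbs φ ≤ ENNReal.ofReal c • GibbsEntropy.gibbs fun x => φ x + U x := by
    have := gibbs_le_smul_gibbs hiΦ hiφ (a := -⨆ y, U y) (b := -⨅ y, U y)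
      (fun x => by simpa using hsup x) fun x => by simpa using hinf x
    rwa [neg_sub_neg] at this
  have hE0 : ∀ x, 0 ≤ GibbsEntropy.energyDensity φ g x * Real.exp (g x) := fun x =>
    mul_nonneg (h.legendreCost_nonneg _ _) (Real.exp_pos _).le
  -- Integrability moves from the perturbed measure to that of φ, where the unperturbed inequality
  -- applies; the entropy bound then moves back at the cost of one factor c.
  have hi' := (hi.smul_measure ENNReal.ofReal_ne_top).mono_measure hφΦ
  have hE' := (hE.smul_measure ENNReal.ofReal_ne_top).mono_measure hφΦ
  have hmain := (h.entropyLE_gibbs hg hi' hE').of_le_smul hi' (fun x => Real.exp_pos _)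
    (Real.exp_pos _).le hΦφ
  refine ⟨hmain.integrable, hmain.entropy_le.trans ?_⟩
  -- The second factor c returns the energy, nonnegative by convexity, to the perturbed measure.
  have hle := integral_mono_measure hφΦ (Eventually.of_forall hE0)
    (hE.smul_measure ENNReal.ofReal_ne_top)
  rw [integral_smul_measure, ENNReal.toReal_ofReal (Real.exp_pos _).le, smul_eq_mul] at hle
  rw [two_mul, Real.exp_add, mul_assoc]
  exact mul_le_mul_of_nonneg_left hle (Real.exp_pos _).le
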